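/- Let $X, Y$ be real Hilbert spaces, $F:\mathrm{dom}(F)\subset X\to Y$, $y\in Y$, and write $B_r(x_0)=\{x\in X:\|x-x_0\|\le r\}$. **Assumption 1.** $\mathcal R:X\to(-\infty,\infty]$ is proper, lower semi-continuous, and there is $\sigma>0$ with $$\mathcal R(t\bar x+(1-t)x)+\sigma t(1-t)\|\bar x-x\|^2\le t\mathcal R(\bar x)+(1-t)\mathcal R(x)$$ for all $\bar x,x\in\mathrm{dom}(\mathcal R)=\{\mathcal R<\infty\}$, $0\le t\le 1$. For $\xi\in\partial\mathcal R(x)$ let $D_{\mathcal R}^{\xi}(z,x)=\mathcal R(z)-\mathcal R(x)-\langle\xi,z-x\rangle$. **Assumption 2.** There are $\rho>0$, $x_0\in X$, $\xi_0\in\partial\mathcal R(x_0)$ with $B_{2\rho}(x_0)\subset\mathrm{dom}(F)$, and there is $\bar x\in\mathrm{dom}(F)$ with $F(\bar x)=y$ and $D_{\mathcal R}^{\xi_0}(\bar x,x_0)\le\sigma\rho^2$. $F$ is weakly closed: if $u_n\in\mathrm{dom}(F)$, $u_n\rightharpoonup x$ weakly in $X$ and $F(u_n)\to v$ in $Y$,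 then $x\in\mathrm{dom}(F)$ and $F(x)=v$. There are bounded linear operators $L(x):X\to Y$, $x\in B_{2\rho}(x_0)$, depending continuously on $x$ in the operator norm, and constants $0\le\eta<1$, $\Lambda>0$, such that $\|L(x)\|\le\Lambda$ and $\|F(x)-F(\bar x)-L(\bar x)(x-\bar x)\|\le\eta\|F(x)-F(\bar x)\|$ for all $x,\bar x\in B_{2\rho}(x_0)$. **Method.** Fix $\tau>1$, $0\le\beta<1$, $\mu_0,\mu_1>0$ with $$c_0=1-\frac{1+\eta}{\tau}-\eta-\frac{\mu_0}{4\sigma}>0 .$$ Given $\delta>0$ and $y^\delta$ with $\|y^\delta-y\|\le\delta$, put $\xi_{-1}^\delta=\xi_0^\delta=\xi_0$, $x_0^\delta=\arg\min_x\{\mathcal R(x)-\langle\xi_0,x\rangle\}=x_0$, $\tilde\gamma_0^\delta=0$. For $n\ge0$ let $r_n^\delta=F(x_n^\delta)-y^\delta$; stop with $n_\delta=n$ if $\|r_n^\delta\|\le\tau\delta$. Otherwise let $g_n^\delta=L(x_n^\delta)^*r_n^\delta$, $m_n^\delta=\xi_n^\delta-\xi_{n-1}^\delta$, let $\alpha_n^\delta=\mu_0/\Lambda^2$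 for all $n$ and all data, or $\alpha_n^\delta=\min\{\mu_0\|r_n^\delta\|^2/\|g_n^\delta\|^2,\mu_1\}$ for all $n$ and all data, let $$\beta_n^\delta=\min\Big\{\max\Big\{0,\frac{\alpha_n^\delta\langle g_n^\delta,m_n^\delta\rangle-2\sigma\tilde\gamma_n^\delta}{\|m_n^\delta\|^2}\Big\},\beta\Big\}\ \text{ if } m_n^\delta\ne0,\qquad \beta_n^\delta=0\ \text{ if } m_n^\delta=0,$$ and set $$\xi_{n+1}^\delta=\xi_n^\delta-\alpha_n^\delta g_n^\delta+\beta_n^\delta m_n^\delta,\qquad x_{n+1}^\delta=\arg\min_{x\in X}\{\mathcal R(x)-\langle\xi_{n+1}^\delta,x\rangle\},$$ $$\tilde\gamma_{n+1}^\delta=\langle m_{n+1}^\delta,x_{n+1}^\delta-x_n^\delta\rangle-(1-\eta)\alpha_n^\delta\|r_n^\delta\|^2+(1+\eta)\alpha_n^\delta\delta\|r_n^\delta\|+\beta_n^\delta\tilde\gamma_n^\delta .$$ **Theorem.** Under Assumptions 1 and 2: 1. There is a unique $x^\dagger$ minimizing $D_{\mathcal R}^{\xi_0}(x,x_0)$ among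 all $x\in\mathrm{dom}(F)$ with $F(x)=y$. 2. For all $\delta>0$ and $y^\delta$ with $\|y^\delta-y\|\le\delta$ the method stops after finitely many steps, and $x_n^\delta\in B_{2\rho}(x_0)$, $\xi_n^\delta\in\partial\mathcal R(x_n^\delta)$ for $0\le n\le n_\delta$. 3. There is $x^*\in B_{2\rho}(x_0)\cap\mathrm{dom}(\mathcal R)$ with $F(x^*)=y$, independent of the noisy data, such that for every family $(y^\delta)_{\delta>0}$ with $\|y^\delta-y\|\le\delta$ $$\lim_{\delta\to0}D_{\mathcal R}^{\xi_{n_\delta}^\delta}(x^*,x_{n_\delta}^\delta)=0\quad\text{and}\quad\lim_{\delta\to0}\|x_{n_\delta}^\delta-x^*\|=0 .$$ If, in addition, $\mathrm{Ker}(L(x^\dagger))\subset\mathrm{Ker}(L(x))$ for all $x\in B_{2\rho}(x_0)$, then $x^*=x^\dagger$. -/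

import Mathlib

open Filter Topology Metric

namespace AHB

variable {X Y : Type*} [NormedAddCommGroup X] [InnerProductSpace ℝ X] [CompleteSpace X]
  [NormedAddCommGroup Y] [InnerProductSpace ℝ Y] [CompleteSpace Y]

/-- `ξ ∈ ∂R(x)`, for an extended real valued function `R`. -/
def IsSubgradient (R : X → EReal) (ξ x : X) : Prop :=
  ∀ z : X, R x + ((inner ℝ ξ (z - x) : ℝ) : EReal) ≤ R z

/-- The Bregman distance `D_R^ξ(z, x) = R(z) - R(x) - ⟨ξ, z - x⟩`, meant for `ξ ∈ ∂R(x)`.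
For proper `R` without the value `⊥` the number `R x` is then finite. -/
noncomputable def bregman (R : X → EReal) (ξ z x : X) : EReal :=
  R z - R x - ((inner ℝ ξ (z - x) : ℝ) : EReal)

/-- `R : X → (-∞, ∞]` is proper, lower semi-continuous and strongly convex with constant `σ`. -/
structure StronglyConvexRegularizer (R : X → EReal) (σ : ℝ) : Prop where
  ne_bot : ∀ x, R x ≠ ⊥
  proper : ∃ x, R x ≠ ⊤
  lsc : LowerSemicontinuous R
  sigma_pos : 0 < σ
  strongly_convex : ∀ u v : X, R u < ⊤ → R v < ⊤ → ∀ t : ℝ, 0 ≤ t → t ≤ 1 →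
    R (t • u + (1 - t) • v) + ((σ * t * (1 - t) * ‖u - v‖ ^ 2 : ℝ) : EReal)
      ≤ (t : EReal) * R u + ((1 - t : ℝ) : EReal) * R v

/-- The conditions on the forward operator `F` with domain `D` and the exact data `y`, on the closed
ball of radius `2ρ` around `x₀`. Only the values of `F` on `D` and of `L` on the ball matter;
`Λ` is the uniform bound for the norms of the operators `L x`. -/
structure ForwardAssumption (R : X → EReal) (σ : ℝ) (F : X → Y) (D : Set X) (y : Y)
    (L : X → X →L[ℝ] Y) (x₀ ξ₀ : X) (ρ η Λ : ℝ) : Prop where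
  rho_pos : 0 < ρ
  subgradient : IsSubgradient R ξ₀ x₀
  ball_subset : closedBall x₀ (2 * ρ) ⊆ D
  exists_solution : ∃ z ∈ D, F z = y ∧ bregman R ξ₀ z x₀ ≤ ((σ * ρ ^ 2 : ℝ) : EReal)
  weakly_closed : ∀ (u : ℕ → X) (x : X) (v : Y), (∀ n, u n ∈ D) →
    Tendsto (fun n => toWeakSpace ℝ X (u n)) atTop (𝓝 (toWeakSpace ℝ X x)) →
    Tendsto (fun n => F (u n)) atTop (𝓝 v) → x ∈ D ∧ F x = v
  continuous_L : ContinuousOn L (closedBall x₀ (2 * ρ))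
  eta_nonneg : 0 ≤ η
  eta_lt_one : η < 1
  tangential_cone : ∀ x ∈ closedBall x₀ (2 * ρ), ∀ z ∈ closedBall x₀ (2 * ρ),
    ‖F x - F z - L z (x - z)‖ ≤ η * ‖F x - F z‖
  bound_pos : 0 < Λ
  norm_L_le : ∀ x ∈ closedBall x₀ (2 * ρ), ‖L x‖ ≤ Λ

/-- `x` is a solution of `F(x) = y` of minimal Bregman distance to `x₀` in the direction `ξ₀`. -/
def IsMinimalSolution (R : X → EReal) (F : X → Y) (D : Set X) (y : Y) (x₀ ξ₀ x : X) : Prop :=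
  x ∈ D ∧ F x = y ∧ ∀ z ∈ D, F z = y → bregman R ξ₀ x x₀ ≤ bregman R ξ₀ z x₀

/-- A minimizer over `X` of `z ↦ R(z) - ⟨ξ, z⟩` (arbitrary if there is none; for a
`StronglyConvexRegularizer` there is exactly one). -/
noncomputable def argmin (R : X → EReal) (ξ : X) : X :=
  Classical.epsilon fun x : X =>
    ∀ z : X, R x - ((inner ℝ ξ x : ℝ) : EReal) ≤ R z - ((inner ℝ ξ z : ℝ) : EReal)

/-- The two admissible step-size rules. -/
inductive StepRule
  | constant
  | adaptive

/-- Everything that the adaptive heavy ball iteration uses apart from the noisy data and the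
noise level. -/
structure Method (X Y : Type*) [NormedAddCommGroup X] [InnerProductSpace ℝ X]
    [NormedAddCommGroup Y] [InnerProductSpace ℝ Y] where
  R : X → EReal
  F : X → Y
  L : X → X →L[ℝ] Y
  ξ₀ : X
  σ : ℝ
  η : ℝ
  Λ : ℝ
  μ₀ : ℝ
  μ₁ : ℝ
  β : ℝ
  rule : StepRule

/-- The quantities `ξ_n`, `ξ_{n-1}`, `x_n`, `γ̃_n` carried from one iteration to the next. -/
structure State (X : Type*) where
  ξ : X
  ξprev : X
  x : X
  γ : ℝ

namespace Method

/-- `r_n = F(x_n) - y^δ`. -/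
def residual (M : Method X Y) (yδ : Y) (s : State X) : Y := M.F s.x - yδ

/-- `g_n = L(x_n)^* r_n`. -/
noncomputable def gradient (M : Method X Y) (yδ : Y) (s : State X) : X :=
  ContinuousLinearMap.adjoint (M.L s.x) (M.residual yδ s)

/-- `m_n = ξ_n - ξ_{n-1}`. -/
def momentum (s : State X) : X := s.ξ - s.ξprev

/-- The step-size `α_n`. -/
noncomputable def alpha (M : Method X Y) (yδ : Y) (s : State X) : ℝ :=
  match M.rule with
  | StepRule.constant => M.μ₀ / M.Λ ^ 2
  | StepRule.adaptive =>
      min (M.μ₀ * ‖M.residual yδ s‖ ^ 2 / ‖M.gradient yδ s‖ ^ 2) M.μ₁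

open Classical in
/-- The momentum coefficient `β_n`. -/
noncomputable def beta (M : Method X Y) (yδ : Y) (s : State X) : ℝ :=
  if momentum s = 0 then 0
  else min (max 0 ((M.alpha yδ s * inner ℝ (M.gradient yδ s) (momentum s)
    - 2 * M.σ * s.γ) / ‖momentum s‖ ^ 2)) M.β

/-- `ξ_{n+1} = ξ_n - α_n g_n + β_n m_n`. -/
noncomputable def nextXi (M : Method X Y) (yδ : Y) (s : State X) : X :=
  s.ξ - M.alpha yδ s • M.gradient yδ s + M.beta yδ s • momentum s

/-- One iteration of the method; the last field is the recursion for `γ̃_{n+1}`. -/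
noncomputable def step (M : Method X Y) (δ : ℝ) (yδ : Y) (s : State X) : State X where
  ξ := M.nextXi yδ s
  ξprev := s.ξ
  x := argmin M.R (M.nextXi yδ s)
  γ := inner ℝ (M.nextXi yδ s - s.ξ) (argmin M.R (M.nextXi yδ s) - s.x)
    - (1 - M.η) * M.alpha yδ s * ‖M.residual yδ s‖ ^ 2
    + (1 + M.η) * M.alpha yδ s * δ * ‖M.residual yδ s‖
    + M.beta yδ s * s.γ

/-- The state after `n` iterations without stopping, with `ξ_{-1} = ξ_0` and `γ̃_0 = 0`. -/
noncomputable def state (M : Method X Y) (δ : ℝ) (yδ : Y) : ℕ → State X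
  | 0 => { ξ := M.ξ₀, ξprev := M.ξ₀, x := argmin M.R M.ξ₀, γ := 0 }
  | n + 1 => M.step δ yδ (M.state δ yδ n)

/-- The discrepancy principle `‖F(x_n) - y^δ‖ ≤ τ δ` holds at step `n`. -/
def Stops (M : Method X Y) (τ δ : ℝ) (yδ : Y) (n : ℕ) : Prop :=
  ‖M.F (M.state δ yδ n).x - yδ‖ ≤ τ * δ

/-- The output integer `n_δ`: the first `n` at which the discrepancy principle holds. -/
noncomputable def stopIndex (M : Method X Y) (τ δ : ℝ) (yδ : Y) : ℕ :=
  sInf {n : ℕ | M.Stops τ δ yδ n}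

/-- The output `x_{n_δ}^δ`. -/
noncomputable def output (M : Method X Y) (τ δ : ℝ) (yδ : Y) : X :=
  (M.state δ yδ (M.stopIndex τ δ yδ)).x

/-- The dual variable `ξ_{n_δ}^δ` that belongs to the output. -/
noncomputable def outputDual (M : Method X Y) (τ δ : ℝ) (yδ : Y) : X :=
  (M.state δ yδ (M.stopIndex τ δ yδ)).ξ

end Method

end AHB

set_option linter.unusedSectionVars false

/-! The Bregman distance to a solution decreases along the iteration. For subgradients `ξ`, `ξ'` at
`x`, `x'`, the three point identity and strong convexity give `D_ξ'(z, x') ≤ D_ξ(z, x) + ‖ξ' - ξ‖² /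
(4σ) + ⟨ξ' - ξ, x - z⟩`. The gradient part of the update is controlled by the tangential cone
condition, and the momentum part by `γ̃_n`, a computable upper bound for `⟨m_n, x_n - z⟩` valid for
every solution `z` in the ball. The coefficient `β_n` is the minimizer of the resulting quadratic
clamped to `[0, β]`, so momentum never costs anything. Each step before stopping therefore gains `c₀
α_n ‖r_n‖²` (`dist_step_le`). As `α_n` is bounded below, the method stops, and the iterates stay in
the ball.

For exact data the gains are summable. If no residual vanishes, let `N` be an index whose residual
is at most all earlier ones. Then `⟨g_n, x_N - z⟩` is of order `‖r_n‖²` for `n < N`. Unrolling the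
momentum recursion bounds `⟨m_n, x_N - z⟩` by a sequence that is summable because `β < 1`. Hence
`D(x_N, x_m) ≤ V_m - V_N` for a convergent sequence `V`. Along such record indices the iterates are
Cauchy, and lower semicontinuity carries the estimate to their limit, so the whole sequence
converges in Bregman distance (`exists_limit_of_residual_ne_zero`). If a residual vanishes, that
iterate is taken as the limit.

For noisy data, each fixed step converges to the exact one as `δ → 0` while the exact residuals
before it are nonzero (`tendsto_state`). Monotonicity then carries smallness from a fixed index to
the stopping index (`tendsto_dist_output`).

The cone condition also makes the solution set in the ball an affine slice of it, so a minimal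
solution exists uniquely by strong convexity. Under the kernel condition `ξ_n - ξ₀` is orthogonal to
the difference of the limit and the minimal solution, which forces them to agree
(`eq_minimalSolution`). -/

namespace AHB

/-! ### Strongly convex functions, Bregman distances and minimizers. -/

section Regularizer

variable {X : Type*} [NormedAddCommGroup X] [InnerProductSpace ℝ X]
  {R : X → EReal} {σ : ℝ}

/-- The Bregman distance of a real-valued function. -/
noncomputable def realBregman (f : X → ℝ) (ξ z x : X) : ℝ := f z - f x - inner ℝ ξ (z - x)

lemma realBregman_self (f : X → ℝ) (ξ x : X) : realBregman f ξ x x = 0 := by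
  simp [realBregman]

/-- The three point identity. -/
lemma realBregman_sub (f : X → ℝ) (ξ ξ' x x' z : X) :
    realBregman f ξ' z x' - realBregman f ξ z x
      = realBregman f ξ' x x' + inner ℝ (ξ' - ξ) (x - z) := by
  simp only [realBregman, inner_sub_left, inner_sub_right]
  ring

namespace StronglyConvexRegularizer

lemma coe_toReal (hR : StronglyConvexRegularizer R σ) {x : X} (hx : R x < ⊤) :
    ((R x).toReal : EReal) = R x :=
  EReal.coe_toReal hx.ne (hR.ne_bot x)

lemma toReal_convex (hR : StronglyConvexRegularizer R σ) {u v : X} (hu : R u < ⊤) (hv : R v < ⊤)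
    {t : ℝ} (h0 : 0 ≤ t) (h1 : t ≤ 1) :
    R (t • u + (1 - t) • v) < ⊤ ∧
      (R (t • u + (1 - t) • v)).toReal + σ * t * (1 - t) * ‖u - v‖ ^ 2
        ≤ t * (R u).toReal + (1 - t) * (R v).toReal := by
  have h := hR.strongly_convex u v hu hv t h0 h1
  rw [← hR.coe_toReal hu, ← hR.coe_toReal hv, ← EReal.coe_mul, ← EReal.coe_mul,
    ← EReal.coe_add] at h
  have hlt : R (t • u + (1 - t) • v) < ⊤ := by
    by_contra hne
    rw [not_lt, top_le_iff] at hne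
    rw [hne, EReal.top_add_coe, top_le_iff] at h
    exact EReal.coe_ne_top _ h
  refine ⟨hlt, ?_⟩
  rw [← hR.coe_toReal hlt, ← EReal.coe_add] at h
  exact EReal.coe_le_coe_iff.1 h

lemma le_of_tendsto (hR : StronglyConvexRegularizer R σ) {u : ℕ → X} {x : X} {c : ℝ}
    (hu : Tendsto u atTop (𝓝 x)) (hc : ∀ᶠ n in atTop, R (u n) ≤ (c : EReal)) :
    R x ≤ (c : EReal) :=
  (hR.lsc.isClosed_preimage (c : EReal)).mem_of_tendsto hu hc

/-- Properness excludes an infinite value at `x`, so the condition becomes one on real numbers: `x`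
minimizes the tilted function. All later estimates use this form. -/
lemma isSubgradient_iff (hR : StronglyConvexRegularizer R σ) {ξ x : X} :
    IsSubgradient R ξ x ↔ R x < ⊤ ∧ ∀ z, R z < ⊤ →
      (R x).toReal - inner ℝ ξ x ≤ (R z).toReal - inner ℝ ξ z := by
  constructor
  · intro h
    have hx : R x < ⊤ := by
      obtain ⟨z, hz⟩ := hR.proper
      by_contra hne
      rw [not_lt, top_le_iff] at hne
      have := h z
      rw [hne, EReal.top_add_coe, top_le_iff] at this
      exact hz this
    refine ⟨hx, fun z hz => ?_⟩
    have h' := h z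
    rw [← hR.coe_toReal hx, ← hR.coe_toReal hz, ← EReal.coe_add, EReal.coe_le_coe_iff,
      inner_sub_right] at h'
    linarith
  · rintro ⟨hx, h⟩ z
    rcases lt_or_ge (R z) ⊤ with hz | hz
    · rw [← hR.coe_toReal hx, ← hR.coe_toReal hz, ← EReal.coe_add, EReal.coe_le_coe_iff,
        inner_sub_right]
      linarith [h z hz]
    · rw [top_le_iff.1 hz]
      exact le_top

/-- Quadratic growth away from a minimizer over a convex set. -/
lemma growth (hR : StronglyConvexRegularizer R σ) {C : Set X} (hC : Convex ℝ C) {ξ x z : X}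
    (hxC : x ∈ C) (hx : R x < ⊤)
    (hmin : ∀ z ∈ C, R z < ⊤ → (R x).toReal - inner ℝ ξ x ≤ (R z).toReal - inner ℝ ξ z)
    (hzC : z ∈ C) (hz : R z < ⊤) :
    (R x).toReal - inner ℝ ξ x + σ * ‖z - x‖ ^ 2 ≤ (R z).toReal - inner ℝ ξ z := by
  -- Compare `x` with the point `t z + (1 - t) x` and divide by `t`; letting `t → 0` then recovers
  -- the full constant `σ`.
  have key : ∀ t : ℝ, 0 < t → t < 1 → σ * (1 - t) * ‖z - x‖ ^ 2
      ≤ ((R z).toReal - inner ℝ ξ z) - ((R x).toReal - inner ℝ ξ x) := by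
    intro t h0 h1
    obtain ⟨hlt, hle⟩ := hR.toReal_convex hz hx h0.le h1.le
    have hm := hmin _ (hC hzC hxC h0.le (by linarith) (by ring)) hlt
    rw [inner_add_right, inner_smul_right, inner_smul_right] at hm
    have : t * (σ * (1 - t) * ‖z - x‖ ^ 2)
      ≤ t * (((R z).toReal - inner ℝ ξ z) - ((R x).toReal - inner ℝ ξ x)) := by linarith
    exact le_of_mul_le_mul_left this h0
  have hlim : Tendsto (fun t : ℝ => σ * (1 - t) * ‖z - x‖ ^ 2) (𝓝[>] 0)
      (𝓝 (σ * (1 - 0) * ‖z - x‖ ^ 2)) :=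
    (Continuous.tendsto (by fun_prop) 0).mono_left nhdsWithin_le_nhds
  have := _root_.le_of_tendsto hlim (by
    filter_upwards [Ioo_mem_nhdsGT (zero_lt_one' ℝ)] with t ht using key t ht.1 ht.2)
  linarith

lemma lt_top (hR : StronglyConvexRegularizer R σ) {ξ x : X} (h : IsSubgradient R ξ x) :
    R x < ⊤ := (hR.isSubgradient_iff.1 h).1

lemma sq_le_realBregman (hR : StronglyConvexRegularizer R σ) {ξ x z : X}
    (h : IsSubgradient R ξ x) (hz : R z < ⊤) :
    σ * ‖z - x‖ ^ 2 ≤ realBregman (fun u => (R u).toReal) ξ z x := by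
  obtain ⟨hx, hm⟩ := hR.isSubgradient_iff.1 h
  have := hR.growth convex_univ (Set.mem_univ x) hx (fun z _ => hm z) (Set.mem_univ z) hz
  simp only [realBregman, inner_sub_right]
  linarith

lemma realBregman_nonneg (hR : StronglyConvexRegularizer R σ) {ξ x z : X}
    (h : IsSubgradient R ξ x) (hz : R z < ⊤) :
    0 ≤ realBregman (fun u => (R u).toReal) ξ z x :=
  le_trans (mul_nonneg hR.sigma_pos.le (sq_nonneg _)) (hR.sq_le_realBregman h hz)

lemma coe_realBregman (hR : StronglyConvexRegularizer R σ) {ξ x z : X}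
    (hx : R x < ⊤) (hz : R z < ⊤) :
    bregman R ξ z x = (realBregman (fun u => (R u).toReal) ξ z x : EReal) := by
  rw [bregman, realBregman, EReal.coe_sub, EReal.coe_sub, hR.coe_toReal hx, hR.coe_toReal hz]

lemma bregman_eq_top (hR : StronglyConvexRegularizer R σ) {ξ x z : X}
    (hx : R x < ⊤) (hz : R z = ⊤) : bregman R ξ z x = ⊤ := by
  rw [bregman, hz, ← hR.coe_toReal hx, EReal.top_sub_coe, EReal.top_sub_coe]

/-- Adding the two growth inequalities gives `2σ‖x - x'‖² ≤ ⟨ξ - ξ', x - x'⟩`. This yields both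
uniqueness of minimizers and their Lipschitz dependence on the dual variable. -/
lemma norm_sub_le (hR : StronglyConvexRegularizer R σ) {ξ ξ' x x' : X}
    (h : IsSubgradient R ξ x) (h' : IsSubgradient R ξ' x') :
    ‖x - x'‖ ≤ ‖ξ - ξ'‖ / (2 * σ) := by
  have hσ := hR.sigma_pos
  have h1 := hR.sq_le_realBregman h (hR.lt_top h')
  have h2 := hR.sq_le_realBregman h' (hR.lt_top h)
  have h3 := real_inner_le_norm (ξ - ξ') (x - x')
  rw [norm_sub_rev] at h1
  simp only [realBregman, inner_sub_left, inner_sub_right] at h1 h2 h3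
  rw [le_div_iff₀ (by positivity)]
  by_contra hlt
  rw [not_le] at hlt
  have hpos : 0 < ‖x - x'‖ := by
    by_contra h0
    have : ‖x - x'‖ = 0 := le_antisymm (not_lt.1 h0) (norm_nonneg _)
    rw [this, zero_mul] at hlt
    exact absurd hlt (not_lt.2 (norm_nonneg _))
  nlinarith [mul_lt_mul_of_pos_right hlt hpos]

/-- The two opposite Bregman distances add up to `⟨ξ' - ξ, x' - x⟩`. Bounding one below by `σ‖x' -
x‖²` leaves `ab - σb² ≤ a² / (4σ)` for the other. -/
lemma realBregman_le (hR : StronglyConvexRegularizer R σ) {ξ ξ' x x' : X}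
    (h : IsSubgradient R ξ x) (h' : IsSubgradient R ξ' x') :
    realBregman (fun u => (R u).toReal) ξ' x x' ≤ ‖ξ' - ξ‖ ^ 2 / (4 * σ) := by
  have hσ := hR.sigma_pos
  have h1 := hR.sq_le_realBregman h (hR.lt_top h')
  have h3 := real_inner_le_norm (ξ' - ξ) (x' - x)
  rw [le_div_iff₀ (by positivity)]
  simp only [realBregman, inner_sub_left, inner_sub_right] at h1 h3 ⊢
  nlinarith [sq_nonneg (‖ξ' - ξ‖ - 2 * σ * ‖x' - x‖)]

/-- The difference of Bregman distances to the same point is controlled by the dual variables. -/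
lemma realBregman_sub_le (hR : StronglyConvexRegularizer R σ) {ξ ξ' x x' : X} (z : X)
    (h : IsSubgradient R ξ x) (h' : IsSubgradient R ξ' x') :
    realBregman (fun u => (R u).toReal) ξ' z x'
      ≤ realBregman (fun u => (R u).toReal) ξ z x + ‖ξ' - ξ‖ ^ 2 / (4 * σ)
        + inner ℝ (ξ' - ξ) (x - z) := by
  have := hR.realBregman_le h h'
  have := realBregman_sub (fun u => (R u).toReal) ξ ξ' x x' z
  linarith

/-- A tilted strongly convex function attains its minimum on a closed convex set. -/
lemma exists_minimizer [CompleteSpace X] (hR : StronglyConvexRegularizer R σ) {x₀ ξ₀ : X}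
    (h₀ : IsSubgradient R ξ₀ x₀) (ξ : X) {C : Set X} (hC : Convex ℝ C) (hCc : IsClosed C)
    (hne : ∃ z ∈ C, R z < ⊤) :
    ∃ x ∈ C, R x < ⊤ ∧
      ∀ z ∈ C, R z < ⊤ → (R x).toReal - inner ℝ ξ x ≤ (R z).toReal - inner ℝ ξ z := by
  have hσ := hR.sigma_pos
  set h : X → ℝ := fun z => (R z).toReal - inner ℝ ξ z with hh
  set A : Set ℝ := h '' {z | z ∈ C ∧ R z < ⊤} with hA
  have hbdd : BddBelow A := by
    refine ⟨(R x₀).toReal - inner ℝ ξ x₀ - ‖ξ₀ - ξ‖ ^ 2 / (4 * σ), ?_⟩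
    rintro _ ⟨z, ⟨-, hz⟩, rfl⟩
    have h1 := hR.sq_le_realBregman h₀ hz
    have h2 := real_inner_le_norm (ξ₀ - ξ) (x₀ - z)
    have h3 : ‖ξ₀ - ξ‖ * ‖z - x₀‖ - σ * ‖z - x₀‖ ^ 2 ≤ ‖ξ₀ - ξ‖ ^ 2 / (4 * σ) := by
      rw [le_div_iff₀ (by positivity)]
      nlinarith [sq_nonneg (‖ξ₀ - ξ‖ - 2 * σ * ‖z - x₀‖)]
    rw [norm_sub_rev x₀ z] at h2
    simp only [realBregman, inner_sub_left, inner_sub_right] at h1 h2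
    simp only [hh]
    linarith
  have hAne : A.Nonempty := by
    obtain ⟨z, hzC, hz⟩ := hne
    exact ⟨h z, z, ⟨hzC, hz⟩, rfl⟩
  have hinf : ∀ z ∈ C, R z < ⊤ → sInf A ≤ h z := fun z hzC hz => csInf_le hbdd ⟨z, ⟨hzC, hz⟩, rfl⟩
  have hex : ∀ n : ℕ, ∃ z, (z ∈ C ∧ R z < ⊤) ∧ h z < sInf A + 1 / ((n : ℝ) + 1) := by
    intro n
    obtain ⟨_, ⟨z, hz, rfl⟩, hlt⟩ := exists_lt_of_csInf_lt hAne
      (show sInf A < sInf A + 1 / ((n : ℝ) + 1) from lt_add_of_pos_right _ (by positivity))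
    exact ⟨z, hz, hlt⟩
  choose u hu hlt using hex
  -- Strong convexity at the midpoint: near-minimizers are close to each other, so a minimizing
  -- sequence is Cauchy.
  have hdist : ∀ a b : X, a ∈ C → R a < ⊤ → b ∈ C → R b < ⊤ → ∀ ε : ℝ, h a < sInf A + ε →
      h b < sInf A + ε → σ * ‖a - b‖ ^ 2 ≤ 4 * ε := by
    intro a b haC ha hbC hb ε hae hbe
    obtain ⟨hlt', hle⟩ := hR.toReal_convex ha hb (t := 1 / 2) (by norm_num) (by norm_num)
    have := hinf _ (hC haC hbC (a := 1 / 2) (b := 1 - 1 / 2) (by norm_num) (by norm_num)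
      (by norm_num)) hlt'
    simp only [hh, inner_add_right, inner_smul_right] at this hae hbe
    linarith
  have hcauchy : CauchySeq u := by
    rw [Metric.cauchySeq_iff']
    intro ε hε
    obtain ⟨N, hN⟩ := exists_nat_one_div_lt (show 0 < σ * ε ^ 2 / 4 by positivity)
    refine ⟨N, fun n hn => ?_⟩
    have h1 : (1 : ℝ) / ((n : ℝ) + 1) ≤ 1 / ((N : ℝ) + 1) :=
      one_div_le_one_div_of_le (by positivity) (by exact_mod_cast Nat.succ_le_succ hn)
    have h2 := hdist (u n) (u N) (hu n).1 (hu n).2 (hu N).1 (hu N).2 (1 / ((N : ℝ) + 1))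
      (by linarith [hlt n]) (hlt N)
    rw [dist_eq_norm]
    have h3 : σ * ‖u n - u N‖ ^ 2 < σ * ε ^ 2 := by linarith
    exact lt_of_pow_lt_pow_left₀ 2 hε.le (lt_of_mul_lt_mul_left h3 hσ.le)
  obtain ⟨x, hx⟩ := cauchySeq_tendsto_of_complete hcauchy
  have hxle : ∀ ε : ℝ, 0 < ε → R x ≤ ((sInf A + inner ℝ ξ x + ε : ℝ) : EReal) := by
    intro ε hε
    refine hR.le_of_tendsto hx ?_
    have h1 : Tendsto (fun n : ℕ => sInf A + 1 / ((n : ℝ) + 1) + inner ℝ ξ (u n)) atTop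
        (𝓝 (sInf A + 0 + inner ℝ ξ x)) :=
      (tendsto_const_nhds.add tendsto_one_div_add_atTop_nhds_zero_nat).add
        (tendsto_const_nhds.inner hx)
    have h2 := h1.eventually (gt_mem_nhds (show sInf A + 0 + inner ℝ ξ x
      < sInf A + inner ℝ ξ x + ε by linarith))
    filter_upwards [h2] with n hn
    rw [← hR.coe_toReal (hu n).2, EReal.coe_le_coe_iff]
    have := hlt n
    simp only [hh] at this
    linarith
  have hxtop : R x < ⊤ := lt_of_le_of_lt (hxle 1 one_pos) (EReal.coe_lt_top _)
  refine ⟨x, hCc.mem_of_tendsto hx (Eventually.of_forall fun n => (hu n).1), hxtop,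
    fun z hzC hz => ?_⟩
  have h1 : (R x).toReal ≤ sInf A + inner ℝ ξ x := by
    refine le_of_forall_pos_le_add fun ε hε => ?_
    have := hxle ε hε
    rwa [← hR.coe_toReal hxtop, EReal.coe_le_coe_iff] at this
  have := hinf z hzC hz
  simp only [hh] at this
  linarith

lemma argmin_isSubgradient [CompleteSpace X] (hR : StronglyConvexRegularizer R σ) {x₀ ξ₀ : X}
    (h₀ : IsSubgradient R ξ₀ x₀) (ξ : X) : IsSubgradient R ξ (argmin R ξ) := by
  obtain ⟨z₀, -, hz₀, hmin⟩ := hR.exists_minimizer h₀ ξ convex_univ isClosed_univ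
    ⟨x₀, Set.mem_univ _, hR.lt_top h₀⟩
  have hcoe : ∀ z, R z < ⊤ → R z - ((inner ℝ ξ z : ℝ) : EReal)
      = (((R z).toReal - inner ℝ ξ z : ℝ) : EReal) := fun z hz => by
    rw [EReal.coe_sub, hR.coe_toReal hz]
  have hspec := Classical.epsilon_spec (p := fun x : X => ∀ z : X,
    R x - ((inner ℝ ξ x : ℝ) : EReal) ≤ R z - ((inner ℝ ξ z : ℝ) : EReal)) ⟨z₀, fun z => by
      rcases lt_or_ge (R z) ⊤ with hz | hz
      · rw [hcoe _ hz₀, hcoe _ hz, EReal.coe_le_coe_iff]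
        exact hmin z (Set.mem_univ z) hz
      · rw [top_le_iff.1 hz, EReal.top_sub_coe]
        exact le_top⟩
  change ∀ z : X, R (argmin R ξ) - ((inner ℝ ξ (argmin R ξ) : ℝ) : EReal)
    ≤ R z - ((inner ℝ ξ z : ℝ) : EReal) at hspec
  have htop : R (argmin R ξ) < ⊤ := by
    by_contra hne
    rw [not_lt, top_le_iff] at hne
    have := hspec z₀
    rw [hne, EReal.top_sub_coe, hcoe _ hz₀, top_le_iff] at this
    exact EReal.coe_ne_top _ this
  refine hR.isSubgradient_iff.2 ⟨htop, fun z hz => ?_⟩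
  have := hspec z
  rwa [hcoe _ htop, hcoe _ hz, EReal.coe_le_coe_iff] at this

lemma eq_of_isSubgradient (hR : StronglyConvexRegularizer R σ) {ξ x x' : X}
    (h : IsSubgradient R ξ x) (h' : IsSubgradient R ξ x') : x = x' := by
  have := hR.norm_sub_le h h'
  rw [sub_self, norm_zero, zero_div] at this
  exact sub_eq_zero.1 (norm_le_zero_iff.1 this)

end StronglyConvexRegularizer

end Regularizer

/-! ### Consequences of the tangential cone condition. -/

section ForwardOperator

variable {X Y : Type*} [NormedAddCommGroup X] [InnerProductSpace ℝ X] [CompleteSpace X]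
  [NormedAddCommGroup Y] [InnerProductSpace ℝ Y] [CompleteSpace Y]
  {R : X → EReal} {σ : ℝ} {F : X → Y} {D : Set X} {y : Y} {L : X → X →L[ℝ] Y} {x₀ ξ₀ : X}
  {ρ η Λ : ℝ}

namespace ForwardAssumption

lemma norm_L_sub_le (hF : ForwardAssumption R σ F D y L x₀ ξ₀ ρ η Λ) {x z : X}
    (hx : x ∈ closedBall x₀ (2 * ρ)) (hz : z ∈ closedBall x₀ (2 * ρ)) :
    ‖L z (x - z)‖ ≤ (1 + η) * ‖F x - F z‖ := by
  have h := hF.tangential_cone x hx z hz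
  have h1 : ‖L z (x - z)‖ ≤ ‖F x - F z‖ + ‖F x - F z - L z (x - z)‖ := by
    calc ‖L z (x - z)‖ = ‖(F x - F z) - (F x - F z - L z (x - z))‖ := by congr 1; abel
      _ ≤ _ := norm_sub_le _ _
  linarith

lemma norm_F_sub_le (hF : ForwardAssumption R σ F D y L x₀ ξ₀ ρ η Λ) {x z : X}
    (hx : x ∈ closedBall x₀ (2 * ρ)) (hz : z ∈ closedBall x₀ (2 * ρ)) :
    (1 - η) * ‖F x - F z‖ ≤ ‖L z (x - z)‖ := by
  have h := hF.tangential_cone x hx z hz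
  have h1 : ‖F x - F z‖ ≤ ‖F x - F z - L z (x - z)‖ + ‖L z (x - z)‖ := by
    calc ‖F x - F z‖ = ‖(F x - F z - L z (x - z)) + L z (x - z)‖ := by congr 1; abel
      _ ≤ _ := norm_add_le _ _
  linarith

/-- `‖F x - F z‖` and `‖L z (x - z)‖` are equivalent up to the factors `1 ± η`. Level sets of `F` in
the ball are thus slices by translates of a kernel. -/
lemma F_eq_iff (hF : ForwardAssumption R σ F D y L x₀ ξ₀ ρ η Λ) {x z : X}
    (hx : x ∈ closedBall x₀ (2 * ρ)) (hz : z ∈ closedBall x₀ (2 * ρ)) :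
    F x = F z ↔ L z (x - z) = 0 := by
  have hη := hF.eta_lt_one
  constructor
  · intro h
    have := hF.norm_L_sub_le hx hz
    rw [h, sub_self, norm_zero, mul_zero] at this
    exact norm_le_zero_iff.1 this
  · intro h
    have := hF.norm_F_sub_le hx hz
    rw [h, norm_zero] at this
    have h1 : ‖F x - F z‖ ≤ 0 := by
      by_contra hpos
      rw [not_le] at hpos
      nlinarith
    exact sub_eq_zero.1 (norm_le_zero_iff.1 h1)

lemma continuousOn_F (hF : ForwardAssumption R σ F D y L x₀ ξ₀ ρ η Λ) :
    ContinuousOn F (closedBall x₀ (2 * ρ)) := by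
  have hη := hF.eta_lt_one
  intro z hz
  rw [ContinuousWithinAt, tendsto_iff_norm_sub_tendsto_zero]
  have hlim : Tendsto (fun x => ‖L z (x - z)‖ / (1 - η)) (𝓝[closedBall x₀ (2 * ρ)] z) (𝓝 0) := by
    have : Continuous fun x => ‖L z (x - z)‖ / (1 - η) := by fun_prop
    have h := this.tendsto z
    simp only [sub_self, map_zero, norm_zero, zero_div] at h
    exact h.mono_left nhdsWithin_le_nhds
  refine squeeze_zero' (Eventually.of_forall fun _ => norm_nonneg _) ?_ hlim
  filter_upwards [self_mem_nhdsWithin] with x hx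
  rw [le_div_iff₀ (by linarith), mul_comm]
  exact hF.norm_F_sub_le hx hz

/-- A point whose Bregman distance to `x₀` is at most `σρ²` is at distance at most `ρ`. -/
lemma mem_closedBall_of_bregman_le (hR : StronglyConvexRegularizer R σ)
    (hF : ForwardAssumption R σ F D y L x₀ ξ₀ ρ η Λ) {z : X}
    (hz : bregman R ξ₀ z x₀ ≤ ((σ * ρ ^ 2 : ℝ) : EReal)) :
    R z < ⊤ ∧ realBregman (fun u => (R u).toReal) ξ₀ z x₀ ≤ σ * ρ ^ 2 ∧ ‖z - x₀‖ ≤ ρ := by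
  have hx₀ := hR.lt_top hF.subgradient
  have htop : R z < ⊤ := by
    by_contra hne
    rw [not_lt, top_le_iff] at hne
    rw [hR.bregman_eq_top hx₀ hne, top_le_iff] at hz
    exact EReal.coe_ne_top _ hz
  rw [hR.coe_realBregman hx₀ htop, EReal.coe_le_coe_iff] at hz
  refine ⟨htop, hz, ?_⟩
  have h1 := (hR.sq_le_realBregman hF.subgradient htop).trans hz
  exact le_of_abs_le
    (abs_le_of_sq_le_sq (le_of_mul_le_mul_left h1 hR.sigma_pos) hF.rho_pos.le)

end ForwardAssumption

end ForwardOperator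

/-! ### Descent of the Bregman distance and finite termination. -/

section Iteration

variable {X Y : Type*} [NormedAddCommGroup X] [InnerProductSpace ℝ X]
  [NormedAddCommGroup Y] [InnerProductSpace ℝ Y]

/-- The standing assumptions on the method, the forward operator and the parameters. -/
structure Setting (M : Method X Y) (D : Set X) (y : Y) (x₀ : X) (ρ τ : ℝ) : Prop where
  reg : StronglyConvexRegularizer M.R M.σ
  fwd : ForwardAssumption M.R M.σ M.F D y M.L x₀ M.ξ₀ ρ M.η M.Λ
  mu₀_pos : 0 < M.μ₀
  mu₁_pos : 0 < M.μ₁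
  beta_nonneg : 0 ≤ M.β
  beta_lt_one : M.β < 1
  one_lt_tau : 1 < τ
  descent_pos : 0 < 1 - (1 + M.η) / τ - M.η - M.μ₀ / (4 * M.σ)

namespace Method

/-- Solutions in the ball around `x₀` at which the regularizer is finite. -/
structure IsSolution (M : Method X Y) (y : Y) (x₀ : X) (ρ : ℝ) (z : X) : Prop where
  mem_ball : z ∈ closedBall x₀ (2 * ρ)
  eq : M.F z = y
  lt_top : M.R z < ⊤

/-- The Bregman distance from a state of the iteration to a point. -/
noncomputable def dist (M : Method X Y) (z : X) (s : State X) : ℝ :=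
  realBregman (fun u => (M.R u).toReal) s.ξ z s.x

/-- The guaranteed relative decrease of the Bregman distance. -/
noncomputable def descentConst (M : Method X Y) (τ : ℝ) : ℝ :=
  1 - (1 + M.η) / τ - M.η - M.μ₀ / (4 * M.σ)

/-- A lower bound for the step sizes. -/
noncomputable def stepBound (M : Method X Y) : ℝ := min (M.μ₀ / M.Λ ^ 2) M.μ₁

/-- The invariants of the iteration. -/
structure Admissible (M : Method X Y) (y : Y) (x₀ : X) (ρ : ℝ) (s : State X) : Prop where
  subgradient : IsSubgradient M.R s.ξ s.x
  mem_ball : s.x ∈ closedBall x₀ (2 * ρ)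
  momentum_le : ∀ z, M.IsSolution y x₀ ρ z → inner ℝ (momentum s) (s.x - z) ≤ s.γ

end Method

namespace Setting

open Method

variable [CompleteSpace X] [CompleteSpace Y]
  {M : Method X Y} {D : Set X} {y yδ : Y} {x₀ z : X} {ρ τ δ : ℝ} {s : State X}

lemma exists_isSolution (h : Setting M D y x₀ ρ τ) :
    ∃ z, M.IsSolution y x₀ ρ z ∧
      realBregman (fun u => (M.R u).toReal) M.ξ₀ z x₀ ≤ M.σ * ρ ^ 2 ∧ ‖z - x₀‖ ≤ ρ := by
  obtain ⟨z, -, hz, hle⟩ := h.fwd.exists_solution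
  obtain ⟨h1, h2, h3⟩ := ForwardAssumption.mem_closedBall_of_bregman_le h.reg h.fwd hle
  have := h.fwd.rho_pos
  refine ⟨z, ⟨?_, hz, h1⟩, h2, h3⟩
  rw [mem_closedBall, dist_eq_norm]
  linarith

lemma argmin_xi₀ (h : Setting M D y x₀ ρ τ) : argmin M.R M.ξ₀ = x₀ :=
  h.reg.eq_of_isSubgradient (h.reg.argmin_isSubgradient h.fwd.subgradient _) h.fwd.subgradient

lemma alpha_nonneg (h : Setting M D y x₀ ρ τ) (yδ : Y) (s : State X) : 0 ≤ M.alpha yδ s := by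
  have h1 := h.mu₀_pos.le
  have h2 := h.mu₁_pos.le
  unfold alpha
  split <;> positivity

lemma norm_gradient_le (h : Setting M D y x₀ ρ τ) (hs : s.x ∈ closedBall x₀ (2 * ρ)) (yδ : Y) :
    ‖M.gradient yδ s‖ ≤ M.Λ * ‖M.residual yδ s‖ := by
  refine (ContinuousLinearMap.le_opNorm _ _).trans ?_
  rw [LinearIsometryEquiv.norm_map]
  exact mul_le_mul_of_nonneg_right (h.fwd.norm_L_le _ hs) (norm_nonneg _)

lemma alpha_mul_sq_le (h : Setting M D y x₀ ρ τ) (hs : s.x ∈ closedBall x₀ (2 * ρ)) (yδ : Y) :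
    M.alpha yδ s * ‖M.gradient yδ s‖ ^ 2 ≤ M.μ₀ * ‖M.residual yδ s‖ ^ 2 := by
  have hΛ := h.fwd.bound_pos
  have hμ := h.mu₀_pos
  unfold alpha
  split
  · rw [div_mul_eq_mul_div, div_le_iff₀ (by positivity)]
    have := pow_le_pow_left₀ (norm_nonneg _) (h.norm_gradient_le hs yδ) 2
    nlinarith
  · refine (mul_le_mul_of_nonneg_right (min_le_left _ _) (sq_nonneg _)).trans ?_
    rcases eq_or_ne (‖M.gradient yδ s‖ ^ 2) 0 with h0 | h0
    · rw [h0, mul_zero]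
      positivity
    · rw [div_mul_cancel₀ _ h0]

/-- The gradient is a direction of descent towards every solution. -/
lemma le_inner_gradient (h : Setting M D y x₀ ρ τ) (hs : s.x ∈ closedBall x₀ (2 * ρ))
    (hz : M.IsSolution y x₀ ρ z) (hδ : ‖yδ - y‖ ≤ δ) :
    (1 - M.η) * ‖M.residual yδ s‖ ^ 2 - (1 + M.η) * δ * ‖M.residual yδ s‖
      ≤ inner ℝ (M.gradient yδ s) (s.x - z) := by
  set r := M.residual yδ s with hr
  have hη := h.fwd.eta_nonneg
  have hcone := h.fwd.tangential_cone z hz.mem_ball s.x hs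
  rw [hz.eq] at hcone
  set e := y - M.F s.x - M.L s.x (z - s.x) with he
  have hL : M.L s.x (s.x - z) = r + (yδ - y) + e := by
    rw [he, hr, Method.residual, ← neg_sub s.x z, map_neg]
    abel
  have hg : inner ℝ (M.gradient yδ s) (s.x - z)
      = ‖r‖ ^ 2 + inner ℝ r (yδ - y) + inner ℝ r e := by
    rw [Method.gradient, ContinuousLinearMap.adjoint_inner_left, ← hr, hL, inner_add_right,
      inner_add_right, real_inner_self_eq_norm_sq]
  have h1 := (abs_le.1 (abs_real_inner_le_norm r (yδ - y))).1
  have h2 := (abs_le.1 (abs_real_inner_le_norm r e)).1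
  have h3 : ‖y - M.F s.x‖ ≤ ‖r‖ + δ := by
    have : y - M.F s.x = -(r + (yδ - y)) := by rw [hr, Method.residual]; abel
    rw [this, norm_neg]
    exact (norm_add_le _ _).trans (by linarith)
  have h4 : ‖e‖ ≤ M.η * (‖r‖ + δ) := hcone.trans (mul_le_mul_of_nonneg_left h3 hη)
  have h5 := mul_le_mul_of_nonneg_left h4 (norm_nonneg r)
  have h6 := mul_le_mul_of_nonneg_left hδ (norm_nonneg r)
  rw [hg]
  nlinarith

/-- Above the discrepancy threshold `δ ≤ r / τ`, so the noise is absorbed by the residual; this is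
the source of `(1 + η) / τ` in `c₀`. -/
lemma noise_term_le (h : Setting M D y x₀ ρ τ) {r : ℝ} (hr : 0 ≤ r) (hτ : τ * δ ≤ r) :
    (1 + M.η) * δ * r ≤ (1 + M.η) / τ * r ^ 2 := by
  have hη := h.fwd.eta_nonneg
  have hτ0 : 0 < τ := by linarith [h.one_lt_tau]
  rw [div_mul_eq_mul_div, le_div_iff₀ hτ0]
  have := mul_le_mul_of_nonneg_right hτ hr
  nlinarith

/-- A vanishing gradient would contradict the descent inequality towards a solution. This keeps the
quotient in the adaptive step size away from a zero denominator. -/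
lemma gradient_ne_zero (h : Setting M D y x₀ ρ τ) (hs : s.x ∈ closedBall x₀ (2 * ρ))
    (hδ : ‖yδ - y‖ ≤ δ) (hτ : τ * δ ≤ ‖M.residual yδ s‖) (hr : M.residual yδ s ≠ 0) :
    M.gradient yδ s ≠ 0 := by
  intro hg
  obtain ⟨z, hz, -⟩ := h.exists_isSolution
  have h1 := h.le_inner_gradient hs hz hδ
  rw [hg, inner_zero_left] at h1
  have h2 := h.noise_term_le (norm_nonneg _) hτ
  have h3 : 0 < ‖M.residual yδ s‖ ^ 2 := by positivity
  have h4 := mul_pos h.descent_pos h3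
  have h5 : 0 ≤ M.μ₀ / (4 * M.σ) * ‖M.residual yδ s‖ ^ 2 := by
    have := h.reg.sigma_pos
    have := h.mu₀_pos
    positivity
  nlinarith

lemma stepBound_pos (h : Setting M D y x₀ ρ τ) : 0 < M.stepBound := by
  have := h.fwd.bound_pos
  have := h.mu₀_pos
  exact lt_min (by positivity) h.mu₁_pos

lemma stepBound_le_alpha (h : Setting M D y x₀ ρ τ) (hs : s.x ∈ closedBall x₀ (2 * ρ))
    (hδ : ‖yδ - y‖ ≤ δ) (hτ : τ * δ ≤ ‖M.residual yδ s‖) (hr : M.residual yδ s ≠ 0) :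
    M.stepBound ≤ M.alpha yδ s := by
  have hΛ := h.fwd.bound_pos
  have hμ := h.mu₀_pos
  have hg := h.gradient_ne_zero hs hδ hτ hr
  unfold alpha stepBound
  split
  · exact min_le_left _ _
  · refine min_le_min_right _ ?_
    rw [div_le_div_iff₀ (by positivity) (by positivity)]
    have := pow_le_pow_left₀ (norm_nonneg _) (h.norm_gradient_le hs yδ) 2
    nlinarith

lemma beta_nonneg' (h : Setting M D y x₀ ρ τ) (yδ : Y) (s : State X) : 0 ≤ M.beta yδ s := by
  have := h.beta_nonneg
  unfold beta
  split
  · exact le_rfl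
  · exact le_min (le_max_left _ _) this

lemma beta_le (h : Setting M D y x₀ ρ τ) (yδ : Y) (s : State X) : M.beta yδ s ≤ M.β := by
  have := h.beta_nonneg
  unfold beta
  split
  · exact this
  · exact min_le_right _ _

/-- The choice of the momentum coefficient does not increase the quadratic it minimizes. -/
lemma beta_quadratic_le (h : Setting M D y x₀ ρ τ) (yδ : Y) (s : State X) :
    M.beta yδ s ^ 2 * ‖momentum s‖ ^ 2 ≤ 2 * M.beta yδ s *
      (M.alpha yδ s * inner ℝ (M.gradient yδ s) (momentum s) - 2 * M.σ * s.γ) := by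
  have h0 := h.beta_nonneg' yδ s
  by_cases hm : momentum s = 0
  · simp [beta, hm]
  set A := M.alpha yδ s * inner ℝ (M.gradient yδ s) (momentum s) - 2 * M.σ * s.γ with hA
  have hb : M.beta yδ s ≤ max 0 (A / ‖momentum s‖ ^ 2) := by
    rw [beta, if_neg hm]
    exact min_le_left _ _
  have hpos : 0 < ‖momentum s‖ ^ 2 := by positivity
  rcases le_total (A / ‖momentum s‖ ^ 2) 0 with hneg | hnn
  · rw [max_eq_left hneg] at hb
    have : M.beta yδ s = 0 := le_antisymm hb h0
    rw [this]
    simp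
  · rw [max_eq_right hnn, le_div_iff₀ hpos] at hb
    nlinarith [mul_nonneg h0 hpos.le]

lemma momentum_step (M : Method X Y) (δ : ℝ) (yδ : Y) (s : State X) :
    momentum (M.step δ yδ s)
      = -(M.alpha yδ s • M.gradient yδ s) + M.beta yδ s • momentum s := by
  simp only [momentum, step, nextXi]
  abel

lemma inner_momentum_step_le (h : Setting M D y x₀ ρ τ) (hs : M.Admissible y x₀ ρ s)
    (hz : M.IsSolution y x₀ ρ z) (hδ : ‖yδ - y‖ ≤ δ) :
    inner ℝ (momentum (M.step δ yδ s)) (s.x - z)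
      ≤ -((1 - M.η) * M.alpha yδ s * ‖M.residual yδ s‖ ^ 2)
        + (1 + M.η) * M.alpha yδ s * δ * ‖M.residual yδ s‖ + M.beta yδ s * s.γ := by
  rw [momentum_step, inner_add_left, inner_neg_left, real_inner_smul_left, real_inner_smul_left]
  have h1 := mul_le_mul_of_nonneg_left (h.le_inner_gradient hs.mem_ball hz hδ)
    (h.alpha_nonneg yδ s)
  have h2 := mul_le_mul_of_nonneg_left (hs.momentum_le z hz) (h.beta_nonneg' yδ s)
  linarith

/-- The recursion for `γ̃` comes from splitting `x_{n+1} - z` at `x_n`: the first part is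
computable, the second is bounded without knowing `z`. -/
lemma momentum_le_step (h : Setting M D y x₀ ρ τ) (hs : M.Admissible y x₀ ρ s)
    (hz : M.IsSolution y x₀ ρ z) (hδ : ‖yδ - y‖ ≤ δ) :
    inner ℝ (momentum (M.step δ yδ s)) ((M.step δ yδ s).x - z) ≤ (M.step δ yδ s).γ := by
  have h1 := h.inner_momentum_step_le hs hz hδ
  have h2 : (M.step δ yδ s).γ = inner ℝ (momentum (M.step δ yδ s)) ((M.step δ yδ s).x - s.x)
    - (1 - M.η) * M.alpha yδ s * ‖M.residual yδ s‖ ^ 2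
    + (1 + M.η) * M.alpha yδ s * δ * ‖M.residual yδ s‖ + M.beta yδ s * s.γ := rfl
  have h3 : (M.step δ yδ s).x - z = ((M.step δ yδ s).x - s.x) + (s.x - z) := by abel
  rw [h2, h3, inner_add_right]
  linarith

lemma subgradient_step (h : Setting M D y x₀ ρ τ) (δ : ℝ) (yδ : Y) (s : State X) :
    IsSubgradient M.R (M.step δ yδ s).ξ (M.step δ yδ s).x :=
  h.reg.argmin_isSubgradient h.fwd.subgradient _

/-- One step of the method decreases the Bregman distance to every solution. -/
lemma dist_step_le (h : Setting M D y x₀ ρ τ) (hs : M.Admissible y x₀ ρ s)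
    (hz : M.IsSolution y x₀ ρ z) (hδ : ‖yδ - y‖ ≤ δ) (hτ : τ * δ ≤ ‖M.residual yδ s‖) :
    M.dist z (M.step δ yδ s)
        + M.descentConst τ * (M.alpha yδ s * ‖M.residual yδ s‖ ^ 2)
      ≤ M.dist z s := by
  have hσ := h.reg.sigma_pos
  have hα := h.alpha_nonneg yδ s
  have h1 := h.reg.realBregman_sub_le z hs.subgradient (h.subgradient_step δ yδ s)
  have h2 := h.inner_momentum_step_le hs hz hδ
  have h3 := h.beta_quadratic_le yδ s
  have h4 := mul_le_mul_of_nonneg_left (h.alpha_mul_sq_le hs.mem_ball yδ) hα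
  have h5 := mul_le_mul_of_nonneg_left (h.noise_term_le (norm_nonneg _) hτ) hα
  have h6 : ‖momentum (M.step δ yδ s)‖ ^ 2 = M.alpha yδ s ^ 2 * ‖M.gradient yδ s‖ ^ 2
      - 2 * M.alpha yδ s * M.beta yδ s * inner ℝ (M.gradient yδ s) (momentum s)
      + M.beta yδ s ^ 2 * ‖momentum s‖ ^ 2 := by
    rw [momentum_step, norm_add_sq_real, norm_neg, norm_smul, norm_smul, mul_pow, mul_pow,
      Real.norm_eq_abs, Real.norm_eq_abs, sq_abs, sq_abs, inner_neg_left, real_inner_smul_left,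
      real_inner_smul_right]
    ring
  -- The choice of `β_n` bounds its terms in the square by `-4σ β_n γ̃_n`. After division by `4σ`
  -- this cancels the `β_n γ̃_n` in `h2`.
  have h7 : ‖momentum (M.step δ yδ s)‖ ^ 2 / (4 * M.σ)
      ≤ M.μ₀ / (4 * M.σ) * (M.alpha yδ s * ‖M.residual yδ s‖ ^ 2) - M.beta yδ s * s.γ := by
    rw [div_le_iff₀ (by positivity), h6]
    have : (M.μ₀ / (4 * M.σ) * (M.alpha yδ s * ‖M.residual yδ s‖ ^ 2) - M.beta yδ s * s.γ)
        * (4 * M.σ) = M.μ₀ * (M.alpha yδ s * ‖M.residual yδ s‖ ^ 2)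
          - 4 * M.σ * (M.beta yδ s * s.γ) := by
      field_simp
    rw [this]
    linarith
  change M.dist z (M.step δ yδ s) ≤ M.dist z s + ‖momentum (M.step δ yδ s)‖ ^ 2 / (4 * M.σ)
    + inner ℝ (momentum (M.step δ yδ s)) (s.x - z) at h1
  unfold descentConst
  linarith

lemma dist_nonneg (h : Setting M D y x₀ ρ τ) (hs : IsSubgradient M.R s.ξ s.x)
    (hz : M.R z < ⊤) : 0 ≤ M.dist z s :=
  h.reg.realBregman_nonneg hs hz

lemma admissible_init (h : Setting M D y x₀ ρ τ) (δ : ℝ) (yδ : Y) :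
    M.Admissible y x₀ ρ (M.state δ yδ 0) where
  subgradient := h.reg.argmin_isSubgradient h.fwd.subgradient _
  mem_ball := by
    have := h.fwd.rho_pos
    change argmin M.R M.ξ₀ ∈ _
    rw [h.argmin_xi₀]
    exact mem_closedBall_self (by linarith)
  momentum_le z _ := by
    simp [momentum, state]

/-- The iterates are admissible as long as the residual has not fallen below the threshold. -/
lemma admissible_and_dist_le (h : Setting M D y x₀ ρ τ) (hδ : ‖yδ - y‖ ≤ δ) (n : ℕ)
    (hn : ∀ k < n, τ * δ ≤ ‖M.residual yδ (M.state δ yδ k)‖) :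
    M.Admissible y x₀ ρ (M.state δ yδ n) ∧ ∀ z, M.IsSolution y x₀ ρ z →
      M.dist z (M.state δ yδ n) ≤ M.dist z (M.state δ yδ 0) := by
  induction n with
  | zero => exact ⟨h.admissible_init δ yδ, fun z _ => le_rfl⟩
  | succ n ih =>
    obtain ⟨hadm, hle⟩ := ih fun k hk => hn k (by omega)
    have hdist : ∀ z, M.IsSolution y x₀ ρ z →
        M.dist z (M.state δ yδ (n + 1)) ≤ M.dist z (M.state δ yδ 0) := by
      intro z hz
      have h1 := h.dist_step_le hadm hz hδ (hn n (by omega))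
      have h2 : 0 ≤ M.descentConst τ * (M.alpha yδ (M.state δ yδ n) *
          ‖M.residual yδ (M.state δ yδ n)‖ ^ 2) :=
        mul_nonneg h.descent_pos.le (mul_nonneg (h.alpha_nonneg _ _) (sq_nonneg _))
      have h3 := hle z hz
      change M.dist z (M.step δ yδ (M.state δ yδ n)) ≤ _
      linarith
    refine ⟨⟨h.subgradient_step δ yδ _, ?_, fun z hz => h.momentum_le_step hadm hz hδ⟩, hdist⟩
    -- The reference solution is within `ρ` of `x₀`, and its initial Bregman distance is at most
    -- `σρ²`. By monotonicity and strong convexity the new iterate is within `ρ` of it, hence the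
    -- radius `2ρ`.
    obtain ⟨z, hz, hz1, hz2⟩ := h.exists_isSolution
    have h1 := h.reg.sq_le_realBregman (h.subgradient_step δ yδ (M.state δ yδ n)) hz.lt_top
    have h2 : M.dist z (M.state δ yδ (n + 1)) ≤ M.σ * ρ ^ 2 := by
      refine (hdist z hz).trans ?_
      change realBregman _ M.ξ₀ z (argmin M.R M.ξ₀) ≤ _
      rw [h.argmin_xi₀]
      exact hz1
    have h3 := le_of_abs_le (abs_le_of_sq_le_sq
      (le_of_mul_le_mul_left (h1.trans h2) h.reg.sigma_pos) h.fwd.rho_pos.le)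
    change (M.step δ yδ (M.state δ yδ n)).x ∈ _
    rw [mem_closedBall, dist_eq_norm]
    calc ‖(M.step δ yδ (M.state δ yδ n)).x - x₀‖
        ≤ ‖(M.step δ yδ (M.state δ yδ n)).x - z‖ + ‖z - x₀‖ := norm_sub_le_norm_sub_add_norm_sub ..
      _ ≤ 2 * ρ := by rw [norm_sub_rev]; linarith

lemma admissible (h : Setting M D y x₀ ρ τ) (hδ : ‖yδ - y‖ ≤ δ) {n : ℕ}
    (hn : ∀ k < n, τ * δ ≤ ‖M.residual yδ (M.state δ yδ k)‖) :
    M.Admissible y x₀ ρ (M.state δ yδ n) :=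
  (h.admissible_and_dist_le hδ n hn).1

lemma dist_succ_le (h : Setting M D y x₀ ρ τ) (hδ : ‖yδ - y‖ ≤ δ) {n : ℕ}
    (hn : ∀ k < n + 1, τ * δ ≤ ‖M.residual yδ (M.state δ yδ k)‖) (hz : M.IsSolution y x₀ ρ z) :
    M.dist z (M.state δ yδ (n + 1)) + M.descentConst τ *
        (M.alpha yδ (M.state δ yδ n) * ‖M.residual yδ (M.state δ yδ n)‖ ^ 2)
      ≤ M.dist z (M.state δ yδ n) :=
  h.dist_step_le (h.admissible hδ fun k hk => hn k (by omega)) hz hδ (hn n (by omega))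

lemma dist_anti (h : Setting M D y x₀ ρ τ) (hδ : ‖yδ - y‖ ≤ δ) {m n : ℕ} (hmn : m ≤ n)
    (hn : ∀ k < n, τ * δ ≤ ‖M.residual yδ (M.state δ yδ k)‖) (hz : M.IsSolution y x₀ ρ z) :
    M.dist z (M.state δ yδ n) ≤ M.dist z (M.state δ yδ m) := by
  induction n, hmn using Nat.le_induction with
  | base => exact le_rfl
  | succ n _ ih =>
    have h1 := h.dist_succ_le hδ hn hz
    have h2 : 0 ≤ M.descentConst τ * (M.alpha yδ (M.state δ yδ n) *
        ‖M.residual yδ (M.state δ yδ n)‖ ^ 2) :=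
      mul_nonneg h.descent_pos.le (mul_nonneg (h.alpha_nonneg _ _) (sq_nonneg _))
    linarith [ih fun k hk => hn k (by omega)]

lemma sum_le (h : Setting M D y x₀ ρ τ) (hδ : ‖yδ - y‖ ≤ δ) (n : ℕ)
    (hn : ∀ k < n, τ * δ ≤ ‖M.residual yδ (M.state δ yδ k)‖) (hz : M.IsSolution y x₀ ρ z) :
    M.descentConst τ * ∑ k ∈ Finset.range n,
        M.alpha yδ (M.state δ yδ k) * ‖M.residual yδ (M.state δ yδ k)‖ ^ 2
      ≤ M.dist z (M.state δ yδ 0) - M.dist z (M.state δ yδ n) := by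
  induction n with
  | zero => simp
  | succ n ih =>
    have h1 := h.dist_succ_le hδ hn hz
    rw [Finset.sum_range_succ, mul_add]
    linarith [ih fun k hk => hn k (by omega)]

/-- Without stopping, every step would gain at least a fixed positive amount, exhausting the
nonnegative Bregman distance. -/
lemma exists_stops (h : Setting M D y x₀ ρ τ) (hδ0 : 0 < δ) (hδ : ‖yδ - y‖ ≤ δ) :
    ∃ n, M.Stops τ δ yδ n := by
  by_contra hne
  push Not at hne
  have hlt : ∀ k, τ * δ < ‖M.residual yδ (M.state δ yδ k)‖ := fun k => not_le.1 (hne k)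
  have hτ0 : 0 < τ := by linarith [h.one_lt_tau]
  obtain ⟨z, hz, -⟩ := h.exists_isSolution
  set c := M.descentConst τ * (M.stepBound * (τ * δ) ^ 2) with hc
  have hcpos : 0 < c := mul_pos h.descent_pos (mul_pos h.stepBound_pos (by positivity))
  obtain ⟨n, hn⟩ := exists_nat_gt (M.dist z (M.state δ yδ 0) / c)
  rw [div_lt_iff₀ hcpos] at hn
  have h1 := h.sum_le hδ n (fun k _ => (hlt k).le) hz
  have h2 := h.dist_nonneg (h.admissible hδ (n := n) fun k _ => (hlt k).le).subgradient hz.lt_top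
  have h3 : (n : ℝ) * (M.stepBound * (τ * δ) ^ 2) ≤ ∑ k ∈ Finset.range n,
      M.alpha yδ (M.state δ yδ k) * ‖M.residual yδ (M.state δ yδ k)‖ ^ 2 := by
    have hterm : ∀ k ∈ Finset.range n, M.stepBound * (τ * δ) ^ 2
        ≤ M.alpha yδ (M.state δ yδ k) * ‖M.residual yδ (M.state δ yδ k)‖ ^ 2 := by
      intro k _
      have hr : M.residual yδ (M.state δ yδ k) ≠ 0 := by
        rw [← norm_pos_iff]
        exact lt_trans (by positivity) (hlt k)
      have hb := h.stepBound_le_alpha (h.admissible hδ (n := k) fun k _ => (hlt k).le).mem_ball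
        hδ (hlt k).le hr
      exact mul_le_mul hb (pow_le_pow_left₀ (by positivity) (hlt k).le 2) (by positivity)
        (h.alpha_nonneg _ _)
    have := Finset.card_nsmul_le_sum _ _ _ hterm
    rwa [Finset.card_range, nsmul_eq_mul] at this
  have h4 := mul_le_mul_of_nonneg_left h3 h.descent_pos.le
  change M.descentConst τ * _ ≤ M.descentConst τ * _ at h4
  rw [hc] at hn
  linarith

lemma lt_residual_of_lt_stopIndex {k : ℕ} (hk : k < M.stopIndex τ δ yδ) :
    τ * δ ≤ ‖M.residual yδ (M.state δ yδ k)‖ :=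
  (not_le.1 (Nat.notMem_of_lt_sInf (s := {n : ℕ | M.Stops τ δ yδ n}) hk)).le

end Setting

end Iteration

/-! ### Convergence of the iteration with exact data. -/

section ExactData

variable {X Y : Type*} [NormedAddCommGroup X] [InnerProductSpace ℝ X] [CompleteSpace X]
  [NormedAddCommGroup Y] [InnerProductSpace ℝ Y] [CompleteSpace Y]

namespace Method

/-- The state after `n` iterations with exact data. -/
noncomputable def exactState (M : Method X Y) (y : Y) (n : ℕ) : State X := M.state 0 y n

/-- The decrease `α_n ‖r_n‖²` of the iteration with exact data. -/
noncomputable def exactDecrease (M : Method X Y) (y : Y) (n : ℕ) : ℝ :=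
  M.alpha y (M.exactState y n) * ‖M.residual y (M.exactState y n)‖ ^ 2

/-- A summable bound for the contribution of the `n`-th momentum. -/
noncomputable def momentumWeight (M : Method X Y) (y : Y) : ℕ → ℝ
  | 0 => 0
  | n + 1 => M.β * M.momentumWeight y n + M.exactDecrease y n

end Method

namespace Setting

open Method

variable {M : Method X Y} {D : Set X} {y : Y} {x₀ z : X} {ρ τ : ℝ}

lemma admissible_exact (h : Setting M D y x₀ ρ τ) (n : ℕ) :
    M.Admissible y x₀ ρ (M.exactState y n) :=
  h.admissible (by simp) fun k _ => by simp

/-- At noise level zero the threshold condition is vacuous, so all descent results apply at every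
step. -/
lemma residual_exact_le (k : ℕ) : τ * 0 ≤ ‖M.residual y (M.state 0 y k)‖ := by simp

lemma dist_exact_anti (h : Setting M D y x₀ ρ τ) (hz : M.IsSolution y x₀ ρ z) :
    Antitone fun n => M.dist z (M.exactState y n) := fun _ _ hmn =>
  h.dist_anti (by simp) hmn (fun k _ => residual_exact_le k) hz

lemma exactDecrease_nonneg (h : Setting M D y x₀ ρ τ) (n : ℕ) : 0 ≤ M.exactDecrease y n :=
  mul_nonneg (h.alpha_nonneg _ _) (sq_nonneg _)

lemma exists_sum_exactDecrease_le (h : Setting M D y x₀ ρ τ) :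
    ∃ C, ∀ n, ∑ k ∈ Finset.range n, M.exactDecrease y k ≤ C := by
  obtain ⟨z, hz, -⟩ := h.exists_isSolution
  refine ⟨M.dist z (M.exactState y 0) / M.descentConst τ, fun n => ?_⟩
  rw [le_div_iff₀ (show 0 < M.descentConst τ from h.descent_pos), mul_comm]
  have h1 := h.sum_le (δ := 0) (yδ := y) (by simp) n (fun k _ => residual_exact_le k) hz
  have h2 := h.dist_nonneg (h.admissible_exact n).subgradient hz.lt_top
  change M.descentConst τ * ∑ k ∈ Finset.range n, M.exactDecrease y k
    ≤ M.dist z (M.exactState y 0) - M.dist z (M.exactState y n) at h1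
  linarith

lemma tendsto_residual_exact (h : Setting M D y x₀ ρ τ) :
    Tendsto (fun n => M.residual y (M.exactState y n)) atTop (𝓝 0) := by
  obtain ⟨C, hC⟩ := h.exists_sum_exactDecrease_le
  have hsum : Summable (M.exactDecrease y) := summable_of_sum_range_le h.exactDecrease_nonneg hC
  have hb := h.stepBound_pos
  have hsq : Tendsto (fun n => ‖M.residual y (M.exactState y n)‖ ^ 2) atTop (𝓝 0) := by
    have hlim := hsum.tendsto_atTop_zero.div_const M.stepBound
    rw [zero_div] at hlim
    refine squeeze_zero (fun _ => sq_nonneg _) (fun n => ?_) hlim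
    rw [le_div_iff₀ hb]
    rcases eq_or_ne (M.residual y (M.exactState y n)) 0 with h0 | h0
    · rw [h0, norm_zero]
      simpa using h.exactDecrease_nonneg n
    · rw [mul_comm]
      exact mul_le_mul_of_nonneg_right (h.stepBound_le_alpha (δ := 0)
        (h.admissible_exact n).mem_ball (by simp) (residual_exact_le n) h0) (sq_nonneg _)
  rw [tendsto_zero_iff_norm_tendsto_zero]
  have := hsq.sqrt
  simpa using this

lemma momentumWeight_nonneg (h : Setting M D y x₀ ρ τ) (n : ℕ) : 0 ≤ M.momentumWeight y n := by
  induction n with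
  | zero => exact le_rfl
  | succ n ih => exact add_nonneg (mul_nonneg h.beta_nonneg ih) (h.exactDecrease_nonneg n)

/-- Summing the recursion, whose initial value is zero, gives `(1 - β) S_n ≤ C` for the partial
sums. -/
lemma summable_momentumWeight (h : Setting M D y x₀ ρ τ) : Summable (M.momentumWeight y) := by
  obtain ⟨C, hC⟩ := h.exists_sum_exactDecrease_le
  have hβ := h.beta_lt_one
  refine summable_of_sum_range_le (c := C / (1 - M.β)) h.momentumWeight_nonneg fun n => ?_
  rw [le_div_iff₀ (by linarith)]
  have h1 : ∑ k ∈ Finset.range (n + 1), M.momentumWeight y k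
      = M.β * ∑ k ∈ Finset.range n, M.momentumWeight y k
        + ∑ k ∈ Finset.range n, M.exactDecrease y k := by
    rw [Finset.sum_range_succ', Finset.mul_sum, ← Finset.sum_add_distrib]
    exact add_zero _
  rw [Finset.sum_range_succ] at h1
  nlinarith [h.momentumWeight_nonneg n, hC n]

/-- Pass from `w` to `z` through `s.x`: the cone condition costs `2(1 + η)‖r‖` for `w`, whose
residual is no larger, and `(1 + η)‖r‖` for `z`. -/
lemma abs_inner_gradient_le (h : Setting M D y x₀ ρ τ) (hz : M.IsSolution y x₀ ρ z) {w : X}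
    (hw : w ∈ closedBall x₀ (2 * ρ)) {s : State X} (hs : s.x ∈ closedBall x₀ (2 * ρ))
    (hle : ‖M.F w - y‖ ≤ ‖M.residual y s‖) :
    |inner ℝ (M.gradient y s) (w - z)| ≤ 3 * (1 + M.η) * ‖M.residual y s‖ ^ 2 := by
  have hη := h.fwd.eta_nonneg
  rw [Method.gradient, ContinuousLinearMap.adjoint_inner_left]
  refine (abs_real_inner_le_norm _ _).trans ?_
  have h1 := h.fwd.norm_L_sub_le hw hs
  have h2 := h.fwd.norm_L_sub_le hz.mem_ball hs
  have h3 : ‖M.F w - M.F s.x‖ ≤ ‖M.F w - y‖ + ‖M.residual y s‖ := by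
    have : M.F w - M.F s.x = (M.F w - y) - M.residual y s := by rw [Method.residual]; abel
    rw [this]
    exact norm_sub_le _ _
  have h4 : ‖M.F z - M.F s.x‖ = ‖M.residual y s‖ := by
    rw [hz.eq, norm_sub_rev, Method.residual]
  have h5 : ‖M.L s.x (w - z)‖ ≤ ‖M.L s.x (w - s.x)‖ + ‖M.L s.x (z - s.x)‖ := by
    rw [← sub_sub_sub_cancel_right w z s.x, map_sub]
    exact norm_sub_le _ _
  have h6 : ‖M.L s.x (w - z)‖ ≤ 3 * (1 + M.η) * ‖M.residual y s‖ := by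
    rw [h4] at h2
    have := mul_le_mul_of_nonneg_left (h3.trans (add_le_add_left hle _))
      (show 0 ≤ 1 + M.η by linarith)
    linarith
  calc ‖M.residual y s‖ * ‖M.L s.x (w - z)‖
      ≤ ‖M.residual y s‖ * (3 * (1 + M.η) * ‖M.residual y s‖) :=
        mul_le_mul_of_nonneg_left h6 (norm_nonneg _)
    _ = _ := by ring

lemma abs_inner_momentum_le (h : Setting M D y x₀ ρ τ) (hz : M.IsSolution y x₀ ρ z) {N : ℕ}
    (hN : ∀ i < N, ‖M.residual y (M.exactState y N)‖ ≤ ‖M.residual y (M.exactState y i)‖)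
    {n : ℕ} (hn : n ≤ N) :
    |inner ℝ (momentum (M.exactState y n)) ((M.exactState y N).x - z)|
      ≤ 3 * (1 + M.η) * M.momentumWeight y n := by
  have hη := h.fwd.eta_nonneg
  induction n with
  | zero => simp [momentum, exactState, state, momentumWeight]
  | succ n ih =>
    have hstep : momentum (M.exactState y (n + 1)) = _ := momentum_step M 0 y (M.exactState y n)
    have h1 := mul_le_mul_of_nonneg_left (h.abs_inner_gradient_le hz
      (h.admissible_exact N).mem_ball (h.admissible_exact n).mem_ball (hN n (by omega)))
      (h.alpha_nonneg y (M.exactState y n))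
    have h2 : M.beta y (M.exactState y n)
        * |inner ℝ (momentum (M.exactState y n)) ((M.exactState y N).x - z)|
        ≤ M.β * (3 * (1 + M.η) * M.momentumWeight y n) :=
      mul_le_mul (h.beta_le _ _) (ih (by omega)) (abs_nonneg _) h.beta_nonneg
    rw [hstep, inner_add_left, inner_neg_left, real_inner_smul_left, real_inner_smul_left]
    refine (abs_add_le _ _).trans ?_
    rw [abs_neg, abs_mul, abs_mul, abs_of_nonneg (h.alpha_nonneg _ _),
      abs_of_nonneg (h.beta_nonneg' _ _), momentumWeight, exactDecrease]
    linarith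

/-- `ξ_n - ξ_m` is the sum of the momenta with indices `m + 1, …, n`, which explains the ranges. -/
lemma abs_inner_dual_sub_le (h : Setting M D y x₀ ρ τ) (hz : M.IsSolution y x₀ ρ z) {N : ℕ}
    (hN : ∀ i < N, ‖M.residual y (M.exactState y N)‖ ≤ ‖M.residual y (M.exactState y i)‖)
    {m n : ℕ} (hmn : m ≤ n) (hn : n ≤ N) :
    |inner ℝ ((M.exactState y n).ξ - (M.exactState y m).ξ) ((M.exactState y N).x - z)|
      ≤ 3 * (1 + M.η) * (∑ k ∈ Finset.range (n + 1), M.momentumWeight y k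
        - ∑ k ∈ Finset.range (m + 1), M.momentumWeight y k) := by
  induction n, hmn using Nat.le_induction with
  | base => simp
  | succ n _ ih =>
    have h1 := h.abs_inner_momentum_le hz hN hn
    have h2 : (M.exactState y (n + 1)).ξ - (M.exactState y m).ξ
        = momentum (M.exactState y (n + 1))
          + ((M.exactState y n).ξ - (M.exactState y m).ξ) := by
      change _ = ((M.exactState y (n + 1)).ξ - (M.exactState y n).ξ) + _
      abel
    rw [h2, inner_add_left, Finset.sum_range_succ]
    refine (abs_add_le _ _).trans ?_
    linarith [ih (by omega)]

/-- A null sequence of positive numbers has arbitrarily late record lows. -/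
lemma exists_record_low {a : ℕ → ℝ} (hpos : ∀ n, 0 < a n) (hlim : Tendsto a atTop (𝓝 0)) (m : ℕ) :
    ∃ N, m < N ∧ ∀ i < N, a N ≤ a i := by
  classical
  -- The first index whose value lies below all of `a 0, …, a m` is a record: each earlier index
  -- fails against some `a j` with `j ≤ m`.
  have hex : ∃ N, ∀ i ∈ Finset.range (m + 1), a N < a i := by
    have : ∀ᶠ N in atTop, ∀ i ∈ Finset.range (m + 1), a N < a i :=
      (Finset.eventually_all _).2 fun i _ => hlim.eventually (gt_mem_nhds (hpos i))
    exact this.exists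
  have hspec := Nat.find_spec hex
  refine ⟨Nat.find hex, ?_, fun i hi => ?_⟩
  · by_contra hle
    exact lt_irrefl _ (hspec _ (Finset.mem_range.2 (by omega)))
  · have := Nat.find_min hex hi
    push Not at this
    obtain ⟨j, hj, hji⟩ := this
    exact (hspec j hj).le.trans hji

/-- If the iteration with exact data does not terminate, it converges to a solution in Bregman
distance. -/
lemma exists_limit_of_residual_ne_zero (h : Setting M D y x₀ ρ τ)
    (hr : ∀ n, M.residual y (M.exactState y n) ≠ 0) :
    ∃ xs, M.IsSolution y x₀ ρ xs ∧
      Tendsto (fun n => M.dist xs (M.exactState y n)) atTop (𝓝 0) := by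
  have hσ := h.reg.sigma_pos
  have hη := h.fwd.eta_nonneg
  obtain ⟨z, hz, -⟩ := h.exists_isSolution
  -- `V` converges, being a monotone nonnegative sequence minus a multiple of convergent partial
  -- sums.
  set V : ℕ → ℝ := fun n => M.dist z (M.exactState y n)
    - 3 * (1 + M.η) * ∑ k ∈ Finset.range (n + 1), M.momentumWeight y k with hV
  have hVlim : ∃ v, Tendsto V atTop (𝓝 v) :=
    ⟨_, (tendsto_atTop_ciInf (h.dist_exact_anti hz) ⟨0, by
      rintro _ ⟨n, rfl⟩
      exact h.dist_nonneg (h.admissible_exact n).subgradient hz.lt_top⟩).sub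
      (((h.summable_momentumWeight.hasSum.tendsto_sum_nat).comp
        (tendsto_add_atTop_nat 1)).const_mul _)⟩
  obtain ⟨v, hv⟩ := hVlim
  have hrlim := h.tendsto_residual_exact
  have hrec := exists_record_low (fun n => norm_pos_iff.2 (hr n))
    (tendsto_zero_iff_norm_tendsto_zero.1 hrlim)
  have hkey : ∀ m N, m ≤ N →
      (∀ i < N, ‖M.residual y (M.exactState y N)‖ ≤ ‖M.residual y (M.exactState y i)‖) →
      M.dist (M.exactState y N).x (M.exactState y m) ≤ V m - V N := by
    intro m N hmN hN
    have h1 := le_of_abs_le (h.abs_inner_dual_sub_le hz hN hmN le_rfl)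
    have h2 : M.dist (M.exactState y N).x (M.exactState y m)
        = M.dist z (M.exactState y m) - M.dist z (M.exactState y N)
          + inner ℝ ((M.exactState y N).ξ - (M.exactState y m).ξ)
            ((M.exactState y N).x - z) := by
      simp only [Method.dist, realBregman, inner_sub_left, inner_sub_right]
      ring
    simp only [hV]
    linarith
  obtain ⟨φ, hφ, hφrec⟩ := extraction_of_frequently_atTop
    (frequently_atTop.2 fun m => (hrec m).imp fun _ hN => ⟨hN.1.le, hN.2⟩)
  set x : ℕ → X := fun k => (M.exactState y (φ k)).x with hx
  have hVφ : Tendsto (fun k => V (φ k)) atTop (𝓝 v) := hv.comp hφ.tendsto_atTop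
  have hcauchy : CauchySeq x := by
    rw [Metric.cauchySeq_iff']
    intro ε hε
    obtain ⟨N, hN⟩ := Metric.cauchySeq_iff'.1 hVφ.cauchySeq (M.σ * ε ^ 2) (by positivity)
    refine ⟨N, fun n hn => ?_⟩
    have h1 := hkey (φ N) (φ n) (hφ.monotone hn) (hφrec n)
    have h2 := h.reg.sq_le_realBregman (h.admissible_exact (φ N)).subgradient
      (h.reg.lt_top (h.admissible_exact (φ n)).subgradient)
    have h3 := (abs_lt.1 (by simpa [Real.dist_eq] using hN n hn)).1
    have h4 : M.σ * ‖x n - x N‖ ^ 2 < M.σ * ε ^ 2 :=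
      (h2.trans h1).trans_lt (by linarith)
    rw [dist_eq_norm]
    exact lt_of_pow_lt_pow_left₀ 2 hε.le (lt_of_mul_lt_mul_left h4 hσ.le)
  obtain ⟨xs, hxs⟩ := cauchySeq_tendsto_of_complete hcauchy
  have hball : xs ∈ closedBall x₀ (2 * ρ) := isClosed_closedBall.mem_of_tendsto hxs
    (Eventually.of_forall fun k => (h.admissible_exact (φ k)).mem_ball)
  have hFx : M.F xs = y := by
    have h1 : Tendsto (fun k => M.F (x k)) atTop (𝓝 (M.F xs)) :=
      (h.fwd.continuousOn_F xs hball).tendsto.comp (tendsto_nhdsWithin_iff.2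
        ⟨hxs, Eventually.of_forall fun k => (h.admissible_exact (φ k)).mem_ball⟩)
    have h2 : Tendsto (fun k => M.F (x k) - y) atTop (𝓝 0) := hrlim.comp hφ.tendsto_atTop
    exact sub_eq_zero.1 (tendsto_nhds_unique (h1.sub_const y) h2)
  -- Let the record index tend to infinity in `hkey` with `m` fixed. Lower semicontinuity gives
  -- `D(xs, x_m) ≤ V_m - v` up to `ε`, for every `m` and not only for records.
  have hle : ∀ m, ∀ ε : ℝ, 0 < ε → M.R xs ≤ ((V m - v + (M.R (M.exactState y m).x).toReal
      + inner ℝ (M.exactState y m).ξ (xs - (M.exactState y m).x) + ε : ℝ) : EReal) := by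
    intro m ε hε
    refine h.reg.le_of_tendsto hxs ?_
    have hlim : Tendsto (fun k => V m - V (φ k) + (M.R (M.exactState y m).x).toReal
        + inner ℝ (M.exactState y m).ξ (x k - (M.exactState y m).x)) atTop
        (𝓝 (V m - v + (M.R (M.exactState y m).x).toReal
        + inner ℝ (M.exactState y m).ξ (xs - (M.exactState y m).x))) :=
      ((tendsto_const_nhds.sub hVφ).add_const _).add
        (tendsto_const_nhds.inner (hxs.sub_const _))
    filter_upwards [hlim.eventually (gt_mem_nhds (lt_add_of_pos_right _ hε)),
      eventually_ge_atTop m] with k hk hmk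
    rw [← h.reg.coe_toReal (h.reg.lt_top (h.admissible_exact (φ k)).subgradient),
      EReal.coe_le_coe_iff]
    have := hkey m (φ k) (hmk.trans hφ.le_apply) (hφrec k)
    simp only [Method.dist, realBregman] at this
    simp only [hx] at hk
    linarith
  have htop : M.R xs < ⊤ := lt_of_le_of_lt (hle 0 1 one_pos) (EReal.coe_lt_top _)
  refine ⟨xs, ⟨hball, hFx, htop⟩, ?_⟩
  have hVv : Tendsto (fun m => V m - v) atTop (𝓝 0) := by
    simpa using hv.sub_const v
  refine squeeze_zero (fun m => h.dist_nonneg (h.admissible_exact m).subgradient htop)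
    (fun m => ?_) hVv
  refine le_of_forall_pos_le_add fun ε hε => ?_
  have := hle m ε hε
  rw [← h.reg.coe_toReal htop, EReal.coe_le_coe_iff] at this
  simp only [Method.dist, realBregman]
  linarith

/-- This form covers both cases: if a residual vanishes, the first such iterate is the limit and its
index serves for every `ε`. Nonzero residuals before `N` are what stability in the data requires. -/
lemma exists_limit (h : Setting M D y x₀ ρ τ) :
    ∃ xs, M.IsSolution y x₀ ρ xs ∧ ∀ ε > 0, ∃ N,
      (∀ k < N, M.residual y (M.exactState y k) ≠ 0) ∧ M.dist xs (M.exactState y N) < ε := by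
  classical
  by_cases hr : ∀ n, M.residual y (M.exactState y n) ≠ 0
  · obtain ⟨xs, hxs, hlim⟩ := h.exists_limit_of_residual_ne_zero hr
    refine ⟨xs, hxs, fun ε hε => ?_⟩
    obtain ⟨N, hN⟩ := (hlim.eventually (gt_mem_nhds hε)).exists
    exact ⟨N, fun k _ => hr k, hN⟩
  · push Not at hr
    have hadm := h.admissible_exact (Nat.find hr)
    refine ⟨(M.exactState y (Nat.find hr)).x,
      ⟨hadm.mem_ball, sub_eq_zero.1 (Nat.find_spec hr), h.reg.lt_top hadm.subgradient⟩,
      fun ε hε => ⟨Nat.find hr, fun k hk => Nat.find_min hr hk, ?_⟩⟩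
    rw [Method.dist, realBregman_self]
    exact hε

end Setting

end ExactData

/-! ### Stability in the data and the regularization property. -/

section Stability

variable {X Y : Type*} [NormedAddCommGroup X] [InnerProductSpace ℝ X]
  [NormedAddCommGroup Y] [InnerProductSpace ℝ Y]

/-- Componentwise convergence of states. -/
structure State.TendsTo {ι : Type*} (s : ι → State X) (l : Filter ι) (s₀ : State X) : Prop where
  ξ : Tendsto (fun i => (s i).ξ) l (𝓝 s₀.ξ)
  ξprev : Tendsto (fun i => (s i).ξprev) l (𝓝 s₀.ξprev)
  x : Tendsto (fun i => (s i).x) l (𝓝 s₀.x)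
  γ : Tendsto (fun i => (s i).γ) l (𝓝 s₀.γ)

lemma tendsto_operator_apply {ι : Type*} {l : Filter ι} {A : ι → Y →L[ℝ] X} {A₀ : Y →L[ℝ] X}
    {u : ι → Y} {u₀ : Y} (hA : Tendsto A l (𝓝 A₀)) (hu : Tendsto u l (𝓝 u₀)) :
    Tendsto (fun i => A i (u i)) l (𝓝 (A₀ u₀)) :=
  (isBoundedBilinearMap_apply.continuous.tendsto (A₀, u₀)).comp (hA.prodMk_nhds hu)

namespace Setting

open Method

variable [CompleteSpace X] [CompleteSpace Y]
  {M : Method X Y} {D : Set X} {y : Y} {x₀ z : X} {ρ τ : ℝ}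
  {ι : Type*} {l : Filter ι} {s : ι → State X} {s₀ : State X} {yδ : ι → Y} {δ : ι → ℝ}

lemma tendsto_residual (h : Setting M D y x₀ ρ τ) (hs : State.TendsTo s l s₀)
    (hball : ∀ᶠ i in l, (s i).x ∈ closedBall x₀ (2 * ρ)) (hs₀ : s₀.x ∈ closedBall x₀ (2 * ρ))
    (hy : Tendsto yδ l (𝓝 y)) :
    Tendsto (fun i => M.residual (yδ i) (s i)) l (𝓝 (M.residual y s₀)) :=
  ((h.fwd.continuousOn_F _ hs₀).tendsto.comp (tendsto_nhdsWithin_iff.2 ⟨hs.x, hball⟩)).sub hy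

lemma tendsto_gradient (h : Setting M D y x₀ ρ τ) (hs : State.TendsTo s l s₀)
    (hball : ∀ᶠ i in l, (s i).x ∈ closedBall x₀ (2 * ρ)) (hs₀ : s₀.x ∈ closedBall x₀ (2 * ρ))
    (hy : Tendsto yδ l (𝓝 y)) :
    Tendsto (fun i => M.gradient (yδ i) (s i)) l (𝓝 (M.gradient y s₀)) := by
  have hL : Tendsto (fun i => M.L (s i).x) l (𝓝 (M.L s₀.x)) :=
    (h.fwd.continuous_L _ hs₀).tendsto.comp (tendsto_nhdsWithin_iff.2 ⟨hs.x, hball⟩)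
  have hadj : Tendsto (fun i => ContinuousLinearMap.adjoint (M.L (s i).x)) l
      (𝓝 (ContinuousLinearMap.adjoint (M.L s₀.x))) :=
    (ContinuousLinearMap.adjoint.continuous.tendsto _).comp hL
  exact tendsto_operator_apply hadj (h.tendsto_residual hs hball hs₀ hy)

/-- A nonzero exact residual makes the limiting gradient nonzero, so the adaptive quotient is
continuous there. -/
lemma tendsto_alpha (h : Setting M D y x₀ ρ τ) (hs : State.TendsTo s l s₀)
    (hball : ∀ᶠ i in l, (s i).x ∈ closedBall x₀ (2 * ρ)) (hs₀ : s₀.x ∈ closedBall x₀ (2 * ρ))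
    (hy : Tendsto yδ l (𝓝 y)) (hr : M.residual y s₀ ≠ 0) :
    Tendsto (fun i => M.alpha (yδ i) (s i)) l (𝓝 (M.alpha y s₀)) := by
  have hg : M.gradient y s₀ ≠ 0 := h.gradient_ne_zero (δ := 0) hs₀ (by simp) (by simp) hr
  unfold alpha
  cases M.rule with
  | constant => exact tendsto_const_nhds
  | adaptive =>
    exact ((((h.tendsto_residual hs hball hs₀ hy).norm.pow 2).const_mul _).div
      ((h.tendsto_gradient hs hball hs₀ hy).norm.pow 2) (by positivity)).min tendsto_const_nhds

lemma tendsto_momentum (hs : State.TendsTo s l s₀) :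
    Tendsto (fun i => momentum (s i)) l (𝓝 (momentum s₀)) :=
  hs.ξ.sub hs.ξprev

/-- Only the products of the momentum coefficient that enter the iteration are continuous, the
coefficient itself need not be. -/
lemma tendsto_beta_mul (h : Setting M D y x₀ ρ τ) (hs : State.TendsTo s l s₀)
    (hball : ∀ᶠ i in l, (s i).x ∈ closedBall x₀ (2 * ρ)) (hs₀ : M.Admissible y x₀ ρ s₀)
    (hy : Tendsto yδ l (𝓝 y)) (hr : M.residual y s₀ ≠ 0) :
    Tendsto (fun i => M.beta (yδ i) (s i) • momentum (s i)) l
        (𝓝 (M.beta y s₀ • momentum s₀)) ∧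
      Tendsto (fun i => M.beta (yδ i) (s i) * (s i).γ) l (𝓝 (M.beta y s₀ * s₀.γ)) := by
  have hm := tendsto_momentum hs
  have hA : Tendsto (fun i => M.alpha (yδ i) (s i) *
      inner ℝ (M.gradient (yδ i) (s i)) (momentum (s i)) - 2 * M.σ * (s i).γ) l
      (𝓝 (M.alpha y s₀ * inner ℝ (M.gradient y s₀) (momentum s₀) - 2 * M.σ * s₀.γ)) :=
    ((h.tendsto_alpha hs hball hs₀.mem_ball hy hr).mul
      ((h.tendsto_gradient hs hball hs₀.mem_ball hy).inner hm)).sub (hs.γ.const_mul _)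
  by_cases hm₀ : momentum s₀ = 0
  · have hb₀ : M.beta y s₀ = 0 := by rw [beta, if_pos hm₀]
    have habs : ∀ i, |M.beta (yδ i) (s i)| ≤ M.β := fun i => by
      rw [abs_of_nonneg (h.beta_nonneg' _ _)]
      exact h.beta_le _ _
    rw [hb₀, zero_smul, zero_mul]
    constructor
    · rw [hm₀] at hm
      have hlim := hm.norm.const_mul M.β
      rw [norm_zero, mul_zero] at hlim
      refine squeeze_zero_norm (fun i => ?_) hlim
      rw [norm_smul, Real.norm_eq_abs]
      exact mul_le_mul_of_nonneg_right (habs i) (norm_nonneg _)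
    -- With zero limiting momentum, admissibility gives `γ̃ ≥ 0` in the limit. If it is zero,
    -- boundedness of `β_n` suffices; if positive, the numerator in `β_n` is eventually negative and
    -- the clamp returns zero.
    · obtain ⟨z, hz, -⟩ := h.exists_isSolution
      have hγ := hs₀.momentum_le z hz
      rw [hm₀, inner_zero_left] at hγ
      rcases hγ.eq_or_lt with hγ | hγ
      · have hlim := hs.γ.abs.const_mul M.β
        rw [← hγ, abs_zero, mul_zero] at hlim
        refine squeeze_zero_norm (fun i => ?_) hlim
        rw [Real.norm_eq_abs, abs_mul]
        exact mul_le_mul_of_nonneg_right (habs i) (abs_nonneg _)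
      · rw [hm₀, inner_zero_right, mul_zero, zero_sub] at hA
        have hneg : -(2 * M.σ * s₀.γ) < 0 := by
          have := h.reg.sigma_pos
          rw [neg_lt_zero]
          positivity
        refine tendsto_const_nhds.congr' ?_
        filter_upwards [hA.eventually (gt_mem_nhds hneg)] with i hi
        have : M.beta (yδ i) (s i) = 0 := by
          unfold beta
          split
          · rfl
          · rw [max_eq_left (div_nonpos_of_nonpos_of_nonneg hi.le (sq_nonneg _)),
              min_eq_left h.beta_nonneg]
        rw [this, zero_mul]
  · have hb : Tendsto (fun i => M.beta (yδ i) (s i)) l (𝓝 (M.beta y s₀)) := by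
      rw [show M.beta y s₀ = _ from if_neg hm₀]
      refine Tendsto.congr' ?_ ((tendsto_const_nhds.max
        (hA.div (hm.norm.pow 2) (by positivity))).min tendsto_const_nhds)
      filter_upwards [hm.eventually (isOpen_ne.mem_nhds hm₀)] with i hi
      exact (if_neg hi).symm
    exact ⟨hb.smul hm, hb.mul hs.γ⟩

lemma tendsto_argmin (h : Setting M D y x₀ ρ τ) {ξ : ι → X} {ξ' : X}
    (hξ : Tendsto ξ l (𝓝 ξ')) :
    Tendsto (fun i => argmin M.R (ξ i)) l (𝓝 (argmin M.R ξ')) := by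
  rw [tendsto_iff_norm_sub_tendsto_zero] at hξ ⊢
  have hlim := hξ.div_const (2 * M.σ)
  rw [zero_div] at hlim
  exact squeeze_zero (fun _ => norm_nonneg _) (fun i => h.reg.norm_sub_le
    (h.reg.argmin_isSubgradient h.fwd.subgradient _)
    (h.reg.argmin_isSubgradient h.fwd.subgradient _)) hlim

lemma tendsto_step (h : Setting M D y x₀ ρ τ) (hs : State.TendsTo s l s₀)
    (hball : ∀ᶠ i in l, (s i).x ∈ closedBall x₀ (2 * ρ)) (hs₀ : M.Admissible y x₀ ρ s₀)
    (hy : Tendsto yδ l (𝓝 y)) (hδ : Tendsto δ l (𝓝 0)) (hr : M.residual y s₀ ≠ 0) :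
    State.TendsTo (fun i => M.step (δ i) (yδ i) (s i)) l (M.step 0 y s₀) := by
  have hres := (h.tendsto_residual hs hball hs₀.mem_ball hy).norm
  have hα := h.tendsto_alpha hs hball hs₀.mem_ball hy hr
  obtain ⟨hβm, hβγ⟩ := h.tendsto_beta_mul hs hball hs₀ hy hr
  have hξ : Tendsto (fun i => M.nextXi (yδ i) (s i)) l (𝓝 (M.nextXi y s₀)) :=
    (hs.ξ.sub (hα.smul (h.tendsto_gradient hs hball hs₀.mem_ball hy))).add hβm
  have hx := h.tendsto_argmin hξ
  exact ⟨hξ, hs.ξ, hx, ((((hξ.sub hs.ξ).inner (hx.sub hs.x)).sub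
    ((hα.const_mul _).mul (hres.pow 2))).add (((hα.const_mul _).mul hδ).mul hres)).add hβγ⟩

/-- Stability of the iteration with respect to the data, as long as the exact one has not
terminated. -/
lemma tendsto_state (h : Setting M D y x₀ ρ τ) {yδ : ℝ → Y}
    (hyδ : ∀ δ : ℝ, 0 < δ → ‖yδ δ - y‖ ≤ δ) (n : ℕ)
    (hn : ∀ k < n, M.residual y (M.exactState y k) ≠ 0) :
    State.TendsTo (fun δ => M.state δ (yδ δ) n) (𝓝[>] 0) (M.exactState y n) ∧
      ∀ᶠ δ in 𝓝[>] (0 : ℝ), ∀ k < n, τ * δ < ‖M.residual (yδ δ) (M.state δ (yδ δ) k)‖ := by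
  have hδ : Tendsto (fun δ : ℝ => δ) (𝓝[>] 0) (𝓝 0) := tendsto_id.mono_left nhdsWithin_le_nhds
  have hy : Tendsto yδ (𝓝[>] 0) (𝓝 y) := by
    rw [tendsto_iff_norm_sub_tendsto_zero]
    refine squeeze_zero' (Eventually.of_forall fun _ => norm_nonneg _) ?_ hδ
    filter_upwards [self_mem_nhdsWithin] with δ hpos using hyδ δ hpos
  induction n with
  | zero => exact ⟨⟨tendsto_const_nhds, tendsto_const_nhds, tendsto_const_nhds,
      tendsto_const_nhds⟩, Eventually.of_forall fun δ k hk => absurd hk (Nat.not_lt_zero k)⟩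
  | succ n ih =>
    obtain ⟨hs, hev⟩ := ih fun k hk => hn k (by omega)
    have hball : ∀ᶠ δ in 𝓝[>] (0 : ℝ), (M.state δ (yδ δ) n).x ∈ closedBall x₀ (2 * ρ) := by
      filter_upwards [hev, self_mem_nhdsWithin] with δ hδ hpos
      exact (h.admissible (hyδ δ hpos) fun k hk => (hδ k hk).le).mem_ball
    have hr := hn n (by omega)
    refine ⟨h.tendsto_step hs hball (h.admissible_exact n) hy hδ hr, ?_⟩
    have hlt : ∀ᶠ δ in 𝓝[>] (0 : ℝ), τ * δ < ‖M.residual (yδ δ) (M.state δ (yδ δ) n)‖ :=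
      (hδ.const_mul τ).eventually_lt
        (h.tendsto_residual hs hball (h.admissible_exact n).mem_ball hy).norm (by
          rw [mul_zero]
          exact norm_pos_iff.2 hr)
    filter_upwards [hev, hlt] with δ h1 h2 k hk
    rcases Nat.lt_succ_iff_lt_or_eq.1 hk with hk | rfl
    · exact h1 k hk
    · exact h2

/-- Regularization property: convergence of the outputs in Bregman distance. -/
lemma tendsto_dist_output (h : Setting M D y x₀ ρ τ) {xs : X} (hxs : M.IsSolution y x₀ ρ xs)
    (hlim : ∀ ε > 0, ∃ N, (∀ k < N, M.residual y (M.exactState y k) ≠ 0) ∧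
      M.dist xs (M.exactState y N) < ε)
    {yδ : ℝ → Y} (hyδ : ∀ δ : ℝ, 0 < δ → ‖yδ δ - y‖ ≤ δ) :
    Tendsto (fun δ => M.dist xs (M.state δ (yδ δ) (M.stopIndex τ δ (yδ δ)))) (𝓝[>] 0) (𝓝 0) := by
  refine tendsto_order.2 ⟨fun a ha => ?_, fun ε hε => ?_⟩
  · filter_upwards [self_mem_nhdsWithin] with δ hpos
    exact ha.trans_le (h.dist_nonneg (h.admissible (hyδ δ hpos)
      fun k hk => lt_residual_of_lt_stopIndex hk).subgradient hxs.lt_top)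
  obtain ⟨N, hN, hlt⟩ := hlim ε hε
  obtain ⟨hs, hev⟩ := h.tendsto_state hyδ N hN
  have hbound : Tendsto (fun δ => M.dist xs (M.exactState y N)
      + ‖(M.state δ (yδ δ) N).ξ - (M.exactState y N).ξ‖ ^ 2 / (4 * M.σ)
      + inner ℝ ((M.state δ (yδ δ) N).ξ - (M.exactState y N).ξ) ((M.exactState y N).x - xs))
      (𝓝[>] 0) (𝓝 (M.dist xs (M.exactState y N))) := by
    have h1 : Tendsto (fun δ => (M.state δ (yδ δ) N).ξ - (M.exactState y N).ξ) (𝓝[>] 0) (𝓝 0) := by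
      simpa using hs.ξ.sub_const (M.exactState y N).ξ
    have h2 := (((h1.norm.pow 2).div_const (4 * M.σ)).const_add
      (M.dist xs (M.exactState y N))).add (h1.inner
      (tendsto_const_nhds (x := (M.exactState y N).x - xs)))
    simpa using h2
  filter_upwards [hbound.eventually (gt_mem_nhds hlt), hev, self_mem_nhdsWithin]
    with δ h1 h2 hpos
  -- For small `δ` no step before `N` meets the discrepancy principle, so monotonicity applies from
  -- `N` up to the stopping index.
  have hle_index : N ≤ M.stopIndex τ δ (yδ δ) := by
    by_contra hlt'
    rw [not_le] at hlt'
    have hmem : M.Stops τ δ (yδ δ) (M.stopIndex τ δ (yδ δ)) :=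
      Nat.sInf_mem (h.exists_stops hpos (hyδ δ hpos))
    exact absurd (h2 _ hlt') (not_lt.2 hmem)
  have h3 := h.dist_anti (hyδ δ hpos) hle_index (fun k hk => lt_residual_of_lt_stopIndex hk) hxs
  have h4 := h.reg.realBregman_sub_le xs (h.admissible_exact N).subgradient
    (h.admissible (hyδ δ hpos) (n := N) fun k hk => (h2 k hk).le).subgradient
  exact (h3.trans h4).trans_lt h1

/-! ### Minimal solutions and identification of the limit. -/

/-- If the kernels of all `L x` contain `K`, the dual variables stay in `ξ₀` plus the
orthogonal complement of `K`. -/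
lemma inner_dual_sub_eq_zero (h : Setting M D y x₀ ρ τ) {K : Submodule ℝ X}
    (hK : ∀ x ∈ closedBall x₀ (2 * ρ), K ≤ (M.L x).ker) {w : X} (hw : w ∈ K) (n : ℕ) :
    inner ℝ ((M.exactState y n).ξ - M.ξ₀) w = 0 ∧ inner ℝ (momentum (M.exactState y n)) w = 0 := by
  induction n with
  | zero => simp [exactState, state, momentum]
  | succ n ih =>
    have hg : inner ℝ (M.gradient y (M.exactState y n)) w = 0 := by
      have hLw : M.L (M.exactState y n).x w = 0 :=
        LinearMap.mem_ker.1 (hK _ (h.admissible_exact n).mem_ball hw)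
      rw [Method.gradient, ContinuousLinearMap.adjoint_inner_left, hLw, inner_zero_right]
    have hm : inner ℝ (momentum (M.exactState y (n + 1))) w = 0 := by
      rw [show momentum (M.exactState y (n + 1)) = _ from momentum_step M 0 y (M.exactState y n),
        inner_add_left, inner_neg_left, real_inner_smul_left, real_inner_smul_left, hg, ih.2]
      simp
    refine ⟨?_, hm⟩
    have : (M.exactState y (n + 1)).ξ - M.ξ₀
        = momentum (M.exactState y (n + 1)) + ((M.exactState y n).ξ - M.ξ₀) := by
      change _ = ((M.exactState y (n + 1)).ξ - (M.exactState y n).ξ) + _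
      abel
    rw [this, inner_add_left, hm, ih.1, add_zero]

/-- Minimal solutions are the minimizers over the solutions in the ball. -/
lemma isMinimalSolution_iff (h : Setting M D y x₀ ρ τ) {x : X} :
    IsMinimalSolution M.R M.F D y x₀ M.ξ₀ x ↔ M.IsSolution y x₀ ρ x ∧
      ∀ z, M.IsSolution y x₀ ρ z →
        (M.R x).toReal - inner ℝ M.ξ₀ x ≤ (M.R z).toReal - inner ℝ M.ξ₀ z := by
  have hx₀ := h.reg.lt_top h.fwd.subgradient
  have hρ := h.fwd.rho_pos
  constructor
  · rintro ⟨hxD, hFx, hmin⟩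
    obtain ⟨z, hzD, hz, hle⟩ := h.fwd.exists_solution
    obtain ⟨h1, -, h3⟩ := ForwardAssumption.mem_closedBall_of_bregman_le h.reg h.fwd
      ((hmin z hzD hz).trans hle)
    refine ⟨⟨?_, hFx, h1⟩, fun z hz => ?_⟩
    · rw [mem_closedBall, dist_eq_norm]
      linarith
    · have := hmin z (h.fwd.ball_subset hz.mem_ball) hz.eq
      rw [h.reg.coe_realBregman hx₀ h1, h.reg.coe_realBregman hx₀ hz.lt_top,
        EReal.coe_le_coe_iff] at this
      simp only [realBregman, inner_sub_right] at this
      linarith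
  · rintro ⟨hx, hmin⟩
    refine ⟨h.fwd.ball_subset hx.mem_ball, hx.eq, fun z _ hz => ?_⟩
    have hreal : ∀ z, M.IsSolution y x₀ ρ z → bregman M.R M.ξ₀ x x₀ ≤ bregman M.R M.ξ₀ z x₀ := by
      intro z hz
      rw [h.reg.coe_realBregman hx₀ hx.lt_top, h.reg.coe_realBregman hx₀ hz.lt_top,
        EReal.coe_le_coe_iff]
      have := hmin z hz
      simp only [realBregman, inner_sub_right]
      linarith
    rcases le_total (bregman M.R M.ξ₀ z x₀) ((M.σ * ρ ^ 2 : ℝ) : EReal) with hle | hge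
    · obtain ⟨h1, -, h3⟩ := ForwardAssumption.mem_closedBall_of_bregman_le h.reg h.fwd hle
      refine hreal z ⟨?_, hz, h1⟩
      rw [mem_closedBall, dist_eq_norm]
      linarith
    -- A competitor with Bregman distance at least `σρ²`, possibly outside the ball, already loses
    -- to the reference solution.
    · obtain ⟨z', hz', hle, -⟩ := h.exists_isSolution
      refine ((hreal z' hz').trans ?_).trans hge
      rw [h.reg.coe_realBregman hx₀ hz'.lt_top, EReal.coe_le_coe_iff]
      exact hle

/-- The solutions in the ball form a closed convex set. -/
lemma convex_isClosed_solutions (h : Setting M D y x₀ ρ τ) :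
    Convex ℝ {x ∈ closedBall x₀ (2 * ρ) | M.F x = y} ∧
      IsClosed {x ∈ closedBall x₀ (2 * ρ) | M.F x = y} := by
  obtain ⟨z, hz, -⟩ := h.exists_isSolution
  have heq : {x ∈ closedBall x₀ (2 * ρ) | M.F x = y}
      = closedBall x₀ (2 * ρ) ∩ {x | M.L z x = M.L z z} := by
    ext x
    refine and_congr_right fun hx => ?_
    have := h.fwd.F_eq_iff hx hz.mem_ball
    rw [hz.eq, map_sub, sub_eq_zero] at this
    exact this
  rw [heq]
  constructor
  · refine (convex_closedBall x₀ (2 * ρ)).inter ?_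
    exact (convex_singleton (𝕜 := ℝ) (M.L z z)).linear_preimage (M.L z).toLinearMap
  · exact isClosed_closedBall.inter (isClosed_eq (M.L z).continuous continuous_const)

/-- Minimization of a strongly convex function over a closed convex set; quadratic growth gives
uniqueness. -/
lemma existsUnique_isMinimalSolution (h : Setting M D y x₀ ρ τ) :
    ∃! x, IsMinimalSolution M.R M.F D y x₀ M.ξ₀ x := by
  obtain ⟨hconv, hclosed⟩ := h.convex_isClosed_solutions
  obtain ⟨z, hz, -⟩ := h.exists_isSolution
  obtain ⟨x, ⟨hxB, hFx⟩, hx, hmin⟩ := h.reg.exists_minimizer h.fwd.subgradient M.ξ₀ hconv hclosed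
    ⟨z, ⟨hz.mem_ball, hz.eq⟩, hz.lt_top⟩
  refine ⟨x, h.isMinimalSolution_iff.2 ⟨⟨hxB, hFx, hx⟩, fun z hz =>
    hmin z ⟨hz.mem_ball, hz.eq⟩ hz.lt_top⟩, fun x' hx' => ?_⟩
  obtain ⟨hs', hmin'⟩ := h.isMinimalSolution_iff.1 hx'
  have h1 := h.reg.growth hconv ⟨hxB, hFx⟩ hx hmin ⟨hs'.mem_ball, hs'.eq⟩ hs'.lt_top
  have h2 := hmin' x ⟨hxB, hFx, hx⟩
  have hσ := h.reg.sigma_pos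
  have h3 : ‖x' - x‖ ^ 2 ≤ 0 := by
    by_contra hpos
    rw [not_le] at hpos
    have := mul_pos hσ hpos
    linarith
  exact sub_eq_zero.1 (norm_eq_zero.1 (pow_eq_zero_iff two_ne_zero |>.1
    (le_antisymm h3 (sq_nonneg _))))

/-- Under the kernel condition the limit of the iteration is the minimal solution. -/
lemma eq_minimalSolution (h : Setting M D y x₀ ρ τ) {xs xd : X} (hxs : M.IsSolution y x₀ ρ xs)
    (hlim : ∀ ε > 0, ∃ N, M.dist xs (M.exactState y N) < ε)
    (hxd : IsMinimalSolution M.R M.F D y x₀ M.ξ₀ xd)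
    (hker : ∀ x ∈ closedBall x₀ (2 * ρ), (M.L xd).ker ≤ (M.L x).ker) : xs = xd := by
  obtain ⟨hd, hmin⟩ := h.isMinimalSolution_iff.1 hxd
  have hw : xs - xd ∈ (M.L xd).ker :=
    LinearMap.mem_ker.2 ((h.fwd.F_eq_iff hxs.mem_ball hd.mem_ball).1 (hxs.eq.trans hd.eq.symm))
  have hle : (M.R xs).toReal - inner ℝ M.ξ₀ xs ≤ (M.R xd).toReal - inner ℝ M.ξ₀ xd := by
    refine le_of_forall_pos_le_add fun ε hε => ?_
    -- Subtract `D(xd, x_N) ≥ 0` from `D(xs, x_N) < ε`. Only `⟨ξ_N, xs - xd⟩` remains of the dual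
    -- variable, and there `ξ_N` may be replaced by `ξ₀`.
    obtain ⟨N, hN⟩ := hlim ε hε
    have h1 := h.dist_nonneg (h.admissible_exact N).subgradient hd.lt_top
    have h2 := (h.inner_dual_sub_eq_zero (y := y) hker hw N).1
    simp only [Method.dist, realBregman, inner_sub_left, inner_sub_right] at hN h1 h2
    linarith
  exact h.existsUnique_isMinimalSolution.unique (h.isMinimalSolution_iff.2
    ⟨hxs, fun z hz => hle.trans (hmin z hz)⟩) hxd

end Setting

end Stability

end AHB

theorem mainTheorem1 {X Y : Type*}
    [NormedAddCommGroup X] [InnerProductSpace ℝ X] [CompleteSpace X]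
    [NormedAddCommGroup Y] [InnerProductSpace ℝ Y] [CompleteSpace Y]
    (R : X → EReal) (F : X → Y) (D : Set X) (y : Y) (L : X → X →L[ℝ] Y) (x₀ ξ₀ : X)
    (σ ρ η Λ μ₀ μ₁ β τ : ℝ) (rule : AHB.StepRule)
    (hR : AHB.StronglyConvexRegularizer R σ)
    (hF : AHB.ForwardAssumption R σ F D y L x₀ ξ₀ ρ η Λ)
    (hμ₀ : 0 < μ₀) (hμ₁ : 0 < μ₁) (hβ₀ : 0 ≤ β) (hβ₁ : β < 1) (hτ : 1 < τ)
    (hc₀ : 0 < 1 - (1 + η) / τ - η - μ₀ / (4 * σ))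
    (M : AHB.Method X Y)
    (hM : M = { R := R, F := F, L := L, ξ₀ := ξ₀, σ := σ, η := η, Λ := Λ, μ₀ := μ₀, μ₁ := μ₁,
                β := β, rule := rule }) :
    (∃! xd : X, AHB.IsMinimalSolution R F D y x₀ ξ₀ xd) ∧
    (∀ (δ : ℝ) (yδ : Y), 0 < δ → ‖yδ - y‖ ≤ δ →
      (∃ n : ℕ, M.Stops τ δ yδ n) ∧
      ∀ n ≤ M.stopIndex τ δ yδ,
        (M.state δ yδ n).x ∈ Metric.closedBall x₀ (2 * ρ) ∧
        AHB.IsSubgradient R (M.state δ yδ n).ξ (M.state δ yδ n).x) ∧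
    ∃ xs : X, xs ∈ Metric.closedBall x₀ (2 * ρ) ∧ R xs < ⊤ ∧ F xs = y ∧
      (∀ yδ : ℝ → Y, (∀ δ : ℝ, 0 < δ → ‖yδ δ - y‖ ≤ δ) →
        Tendsto (fun δ : ℝ =>
            AHB.bregman R (M.outputDual τ δ (yδ δ)) xs (M.output τ δ (yδ δ)))
          (𝓝[>] 0) (𝓝 0) ∧
        Tendsto (fun δ : ℝ => ‖M.output τ δ (yδ δ) - xs‖) (𝓝[>] 0) (𝓝 0)) ∧
      (∀ xd : X, AHB.IsMinimalSolution R F D y x₀ ξ₀ xd →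
        (∀ x ∈ Metric.closedBall x₀ (2 * ρ), (L xd).ker ≤ (L x).ker) → xs = xd) := by
  have h : AHB.Setting M D y x₀ ρ τ := by
    subst hM
    exact ⟨hR, hF, hμ₀, hμ₁, hβ₀, hβ₁, hτ, hc₀⟩
  have hMR : M.R = R := by rw [hM]
  have hMF : M.F = F := by rw [hM]
  have hML : M.L = L := by rw [hM]
  have hMξ : M.ξ₀ = ξ₀ := by rw [hM]
  clear hM
  subst hMR hMF hML hMξ
  obtain ⟨xs, hxs, hlim⟩ := h.exists_limit
  refine ⟨h.existsUnique_isMinimalSolution, fun δ yδ hpos hδ => ⟨h.exists_stops hpos hδ,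
    fun n hn => ?_⟩, xs, hxs.mem_ball, hxs.lt_top, hxs.eq, fun yδ hyδ => ?_, fun xd hxd hker =>
    h.eq_minimalSolution hxs (fun ε hε => (hlim ε hε).imp fun _ hN => hN.2) hxd hker⟩
  · have hadm := h.admissible hδ (n := n) fun k hk =>
      AHB.Setting.lt_residual_of_lt_stopIndex (hk.trans_le hn)
    exact ⟨hadm.mem_ball, hadm.subgradient⟩
  · have hdist := h.tendsto_dist_output hxs hlim hyδ
    have hsub : ∀ δ : ℝ, 0 < δ → AHB.IsSubgradient M.R (M.outputDual τ δ (yδ δ))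
        (M.output τ δ (yδ δ)) := fun δ hpos => (h.admissible (hyδ δ hpos) fun k hk =>
      AHB.Setting.lt_residual_of_lt_stopIndex hk).subgradient
    constructor
    · refine ((continuous_coe_real_ereal.tendsto 0).comp hdist).congr' ?_
      filter_upwards [self_mem_nhdsWithin] with δ hpos
      exact (h.reg.coe_realBregman (h.reg.lt_top (hsub δ hpos)) hxs.lt_top).symm
    · have hσ := h.reg.sigma_pos
      have hsqrt := (hdist.div_const M.σ).sqrt
      rw [zero_div, Real.sqrt_zero] at hsqrt
      refine squeeze_zero' (Eventually.of_forall fun _ => norm_nonneg _) ?_ hsqrt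
      filter_upwards [self_mem_nhdsWithin] with δ hpos
      refine Real.le_sqrt_of_sq_le ?_
      rw [le_div_iff₀ hσ, norm_sub_rev, mul_comm]
      exact h.reg.sq_le_realBregman (hsub δ hpos) hxs.lt_top
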